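/- Let $n\ge 2$, let $T_A\ge T_B>0$, and let $v_A,v_B\in(0,\infty)^n$ satisfy $\sum_i v_{A,i}=\sum_i v_{B,i}=1$. Players $A$ and $B$ choose nonnegative random allocations $X_A,X_B\in[0,\infty)^n$ independently. Player $P\in\{A,B\}$ with opponent $\bar P$ receives $v_{P,i}$ for every battlefield $i$ with $X_{P,i}>X_{\bar P,i}$; ties are broken by an arbitrary measurable rule. In the Blotto game a mixed strategy of $P$ must satisfy $\sum_i X_{P,i}\le T_P$ almost surely; in the Lotto game it must only satisfy $\sum_i\mathbb E[X_{P,i}]\le T_P$. Payoffs are expected total rewards. Consider pairs $\gamma,\lambda>0$ solving $$\lambda T_A=\frac12\sum_{i=1}^n \min\Big(\gamma v_{B,i},\frac{v_{A,i}^2}{\gamma v_{B,i}}\Big),\qquad \lambda T_B=\frac12\sum_{i=1}^n \min\Big(\frac{(\gamma v_{B,i})^2}{v_{A,i}},v_{A,i}\Big),\tag{1}$$ and the associated marginal distributions $$X_{A,i}\sim\begin{cases}\mathsf{Unif}\big[0,\frac{\gamma v_{B,i}}{\lambda}\big]&\text{if } \frac{v_{A,i}}{v_{B,i}}\ge\gamma,\\[2pt]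 \big(1-\frac{v_{A,i}}{\gamma v_{B,i}}\big)\delta_0+\frac{v_{A,i}}{\gamma v_{B,i}}\mathsf{Unif}\big[0,\frac{v_{A,i}}{\lambda}\big]&\text{otherwise,}\end{cases}$$ $$X_{B,i}\sim\begin{cases}\big(1-\frac{\gamma v_{B,i}}{v_{A,i}}\big)\delta_0+\frac{\gamma v_{B,i}}{v_{A,i}}\mathsf{Unif}\big[0,\frac{\gamma v_{B,i}}{\lambda}\big]&\text{if } \frac{v_{A,i}}{v_{B,i}}\ge\gamma,\\[2pt] \mathsf{Unif}\big[0,\frac{v_{A,i}}{\lambda}\big]&\text{otherwise.}\end{cases}$$ Write $\chi^2(u\|v)=\sum_{i=1}^n u_i^2/v_i-1$, and suppose that for some $r\in(0,1)$ $$\max\big(\chi^2(v_A\|v_B),\,\chi^2(v_B\|v_A)\big)\le r^2\qquad\text{and}\qquad \max_{1\le i\le n} v_{B,i}\le\frac{T_B}{2T_A}(1-r).$$ Then (1) has a solution $\gamma,\lambda>0$; and for every such solution there are a joint law $\pi_A$ on $\mathbb R^n$ with the marginals $X_{A,1},\dots,X_{A,n}$ and a joint law $\pi_B$ on $\mathbb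 R^n$ with the marginals $X_{B,1},\dots,X_{B,n}$ such that, whatever the tie-breaking rule, $(\pi_A,\pi_B)$ is a Nash equilibrium of the Lotto game and also a Nash equilibrium of the Blotto game. -/

import Mathlib

open MeasureTheory ProbabilityTheory

noncomputable section

namespace Blotto

/-- The `χ²`-divergence `χ²(u‖v) = ∑ᵢ uᵢ² / vᵢ - 1` between two (positive) probability vectors. -/
def chiSq {n : ℕ} (u v : Fin n → ℝ) : ℝ := ∑ i, u i ^ 2 / v i - 1

/-! ### The games

An allocation is a vector `x : Fin n → ℝ`, a mixed strategy is a law on allocations. -/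

/-- A rule that breaks ties. If the allocations `x` of player `A` and `y` of player `B` tie on
battlefield `i`, then players `A` and `B` get there the shares (or probabilities of winning)
`shareA x y i` and `shareB x y i`. The shares may depend on everything, and may be deterministic;
the inequality `≤ 1` also covers the rule under which nobody wins a tie. -/
structure TieRule (n : ℕ) where
  shareA : (Fin n → ℝ) → (Fin n → ℝ) → Fin n → ℝ
  shareB : (Fin n → ℝ) → (Fin n → ℝ) → Fin n → ℝ
  shareA_nonneg : ∀ x y i, 0 ≤ shareA x y i
  shareB_nonneg : ∀ x y i, 0 ≤ shareB x y i
  share_add_le_one : ∀ x y i, shareA x y i + shareB x y i ≤ 1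
  measurable_shareA : ∀ i, Measurable fun p : (Fin n → ℝ) × (Fin n → ℝ) => shareA p.1 p.2 i
  measurable_shareB : ∀ i, Measurable fun p : (Fin n → ℝ) × (Fin n → ℝ) => shareB p.1 p.2 i

/-- Payoff of player `A`, with values `vA`, when `A` plays `x` and `B` plays `y`. -/
def payoffA {n : ℕ} (τ : TieRule n) (vA x y : Fin n → ℝ) : ℝ :=
  ∑ i, vA i * (if y i < x i then 1 else if x i = y i then τ.shareA x y i else 0)

/-- Payoff of player `B`, with values `vB`, when `A` plays `x` and `B` plays `y`. -/
def payoffB {n : ℕ} (τ : TieRule n) (vB x y : Fin n → ℝ) : ℝ :=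
  ∑ i, vB i * (if x i < y i then 1 else if x i = y i then τ.shareB x y i else 0)

/-- Expected payoff of player `A` when the players draw their allocations independently from
the mixed strategies `πA` and `πB`. -/
def utilityA {n : ℕ} (τ : TieRule n) (vA : Fin n → ℝ) (πA πB : Measure (Fin n → ℝ)) : ℝ :=
  ∫ p, payoffA τ vA p.1 p.2 ∂(πA.prod πB)

/-- Expected payoff of player `B`. -/
def utilityB {n : ℕ} (τ : TieRule n) (vB : Fin n → ℝ) (πA πB : Measure (Fin n → ℝ)) : ℝ :=
  ∫ p, payoffB τ vB p.1 p.2 ∂(πA.prod πB)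

/-- Admissible mixed strategies of the Blotto game with budget `T`: nonnegative random allocations
that respect the budget almost surely. -/
def BlottoAdmissible {n : ℕ} (T : ℝ) (π : Measure (Fin n → ℝ)) : Prop :=
  IsProbabilityMeasure π ∧ (∀ᵐ x ∂π, ∀ i, 0 ≤ x i) ∧ ∀ᵐ x ∂π, ∑ i, x i ≤ T

/-- Admissible mixed strategies of the Lotto game with budget `T`: nonnegative random allocations
that respect the budget in expectation. -/
def LottoAdmissible {n : ℕ} (T : ℝ) (π : Measure (Fin n → ℝ)) : Prop :=
  IsProbabilityMeasure π ∧ (∀ᵐ x ∂π, ∀ i, 0 ≤ x i) ∧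
    (∀ i, Integrable (fun x : Fin n → ℝ => x i) π) ∧ ∑ i, ∫ x, x i ∂π ≤ T

/-- Nash equilibria in mixed strategies, where `admA` and `admB` are the sets of admissible mixed
strategies of the two players. -/
def IsNash {n : ℕ} (admA admB : Measure (Fin n → ℝ) → Prop) (τ : TieRule n) (vA vB : Fin n → ℝ)
    (πA πB : Measure (Fin n → ℝ)) : Prop :=
  admA πA ∧ admB πB ∧
    (∀ π, admA π → utilityA τ vA π πB ≤ utilityA τ vA πA πB) ∧
    ∀ π, admB π → utilityB τ vB πA π ≤ utilityB τ vB πA πB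

/-- Nash equilibria of the Blotto game with budgets `TA`, `TB` and values `vA`, `vB`. -/
def IsBlottoEquilibrium {n : ℕ} (τ : TieRule n) (TA TB : ℝ) (vA vB : Fin n → ℝ)
    (πA πB : Measure (Fin n → ℝ)) : Prop :=
  IsNash (BlottoAdmissible TA) (BlottoAdmissible TB) τ vA vB πA πB

/-- Nash equilibria of the Lotto game with budgets `TA`, `TB` and values `vA`, `vB`. -/
def IsLottoEquilibrium {n : ℕ} (τ : TieRule n) (TA TB : ℝ) (vA vB : Fin n → ℝ)
    (πA πB : Measure (Fin n → ℝ)) : Prop :=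
  IsNash (LottoAdmissible TA) (LottoAdmissible TB) τ vA vB πA πB

/-! ### The explicit equilibrium marginals of the Lotto game -/

/-- The uniform distribution on `[0, b]`. -/
def unif (b : ℝ) : Measure ℝ := cond volume (Set.Icc 0 b)

/-- The mixture `(1 - p) δ₀ + p Unif[0, b]`. -/
def zeroUnif (p b : ℝ) : Measure ℝ :=
  ENNReal.ofReal (1 - p) • Measure.dirac 0 + ENNReal.ofReal p • unif b

/-- Law of the allocation of player `A` to battlefield `i`. -/
def lottoA {n : ℕ} (vA vB : Fin n → ℝ) (γ lam : ℝ) (i : Fin n) : Measure ℝ :=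
  if γ ≤ vA i / vB i then unif (γ * vB i / lam)
  else zeroUnif (vA i / (γ * vB i)) (vA i / lam)

/-- Law of the allocation of player `B` to battlefield `i`. -/
def lottoB {n : ℕ} (vA vB : Fin n → ℝ) (γ lam : ℝ) (i : Fin n) : Measure ℝ :=
  if γ ≤ vA i / vB i then zeroUnif (γ * vB i / vA i) (γ * vB i / lam)
  else unif (vA i / lam)

/-- `(γ, lam)` solves the two equations which say that the strategies above exhaust the budgets
`TA` and `TB` in expectation. -/
def IsLottoParam {n : ℕ} (TA TB : ℝ) (vA vB : Fin n → ℝ) (γ lam : ℝ) : Prop :=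
  0 < γ ∧ 0 < lam ∧
    lam * TA = 1 / 2 * ∑ i, min (γ * vB i) (vA i ^ 2 / (γ * vB i)) ∧
    lam * TB = 1 / 2 * ∑ i, min ((γ * vB i) ^ 2 / vA i) (vA i)

/-- `π` is a coupling of the laws `μ i`. -/
def IsCoupling {n : ℕ} (μ : Fin n → Measure ℝ) (π : Measure (Fin n → ℝ)) : Prop :=
  ∀ i, π.map (fun x => x i) = μ i

end Blotto

end

/-! Put `b i = min (γ * vB i) (vA i) / lam`. On battlefield `i` both marginals are zero-inflated
uniform laws with the same upper end `b i` and masses `p i`, `q i` on the uniform part, at least one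
of which is 1. The opponent's distribution function is affine on `[0, b i]`, and the parameters make
`vA i * q i / b i = lam` and `vB i * p i / b i = lam / γ` independent of `i`. So the reward for a
bid is at most an affine function of the total bid, with equality almost surely on the equilibrium
bids. Every coupling of the marginals that meets the budgets in expectation is therefore a Lotto
equilibrium (`isLottoEquilibrium_of_coupling`). If the coupled bids also sum to the budget almost
surely, it is a Blotto equilibrium, because Blotto strategies are Lotto strategies.

It remains to couple the laws `(1 - p i) δ₀ + p i Unif[0, b i]` with constant sum `T`. This is
possible once the means add up to `T` and `b i ≤ T` (`exists_zeroUnif_coupling`). By duality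
(`exists_coupling_of_dual`) it is enough that `∑ i, f i (x i) ≥ 0` on the simplex of total `T`
implies that the sum of the expectations of the `f i` is nonnegative. Minimizing the averages of `f
i` over `[0, t]` minus `κ * t`, for a suitable common slope `κ`, bounds that sum below by a sum of
averages over intervals `[s i, t i]` whose midpoints add up to `T` and whose lengths satisfy the
polygon inequality. Uniform laws on such intervals have an explicit coupling with constant sum:
close a polygon with these side lengths, embed its plane in space and project it onto a uniformly
random direction. By Archimedes each projected side is uniform, and the projections cancel.

The χ² bound enters through `one_sub_le_sum_min`, which gives `lam * TA ≥ γ * (1 - r) / 2`. With the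
bound on `vB` this yields `b i ≤ TB ≤ TA`, as the coupling requires. -/

namespace Blotto

/-! ### Integration over the sphere -/

/-- Integral over the unit sphere in spherical coordinates (colatitude `ψ`, azimuth `φ`). -/
noncomputable def sphereInt (k : ℝ → ℝ → ℝ) : ℝ :=
  ∫ ψ in (0 : ℝ)..Real.pi, Real.sin ψ * ∫ φ in (0 : ℝ)..2 * Real.pi, k ψ φ

theorem continuous_sphereInt_inner {k : ℝ → ℝ → ℝ} (hk : Continuous (Function.uncurry k)) :
    Continuous fun ψ => Real.sin ψ * ∫ φ in (0 : ℝ)..2 * Real.pi, k ψ φ :=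
  Real.continuous_sin.mul (intervalIntegral.continuous_parametric_intervalIntegral_of_continuous' hk _ _)

theorem sphereInt_sum {ι : Type*} (s : Finset ι) {k : ι → ℝ → ℝ → ℝ}
    (hk : ∀ i, Continuous (Function.uncurry (k i))) :
    sphereInt (fun ψ φ => ∑ i ∈ s, k i ψ φ) = ∑ i ∈ s, sphereInt (k i) := by
  unfold sphereInt
  rw [← intervalIntegral.integral_finsetSum
    fun i _ => (continuous_sphereInt_inner (hk i)).intervalIntegrable _ _]
  congr 1; ext ψ
  rw [intervalIntegral.integral_finsetSum, Finset.mul_sum]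
  intro i _
  exact ((hk i).comp (Continuous.prodMk_right ψ)).intervalIntegrable _ _

theorem sphereInt_const_mul (c : ℝ) (k : ℝ → ℝ → ℝ) :
    sphereInt (fun ψ φ => c * k ψ φ) = c * sphereInt k := by
  unfold sphereInt
  rw [← intervalIntegral.integral_const_mul]
  congr 1; ext ψ
  rw [intervalIntegral.integral_const_mul]; ring

theorem sphereInt_const (c : ℝ) : sphereInt (fun _ _ => c) = 4 * Real.pi * c := by
  simp only [sphereInt, intervalIntegral.integral_const, intervalIntegral.integral_mul_const,
    integral_sin, Real.cos_zero, Real.cos_pi, smul_eq_mul]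
  ring

theorem sphereInt_mono {k l : ℝ → ℝ → ℝ} (hk : Continuous (Function.uncurry k))
    (hl : Continuous (Function.uncurry l)) (h : ∀ ψ φ, k ψ φ ≤ l ψ φ) :
    sphereInt k ≤ sphereInt l := by
  unfold sphereInt
  refine intervalIntegral.integral_mono_on Real.pi_pos.le
    ((continuous_sphereInt_inner hk).intervalIntegrable _ _)
    ((continuous_sphereInt_inner hl).intervalIntegrable _ _) fun ψ hψ => ?_
  refine mul_le_mul_of_nonneg_left ?_ (Real.sin_nonneg_of_nonneg_of_le_pi hψ.1 hψ.2)
  exact intervalIntegral.integral_mono_on (by positivity)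
    ((hk.comp (Continuous.prodMk_right ψ)).intervalIntegrable _ _)
    ((hl.comp (Continuous.prodMk_right ψ)).intervalIntegrable _ _) fun φ _ => h ψ φ

/-- The product telescopes. Its factors are the Wallis products of the odd sine power in `ψ` and of
the even sine power in `φ`, so their product gives the even moments of the uniform law on `[-1, 1]`.
-/
theorem prod_mul_prod_wallis (m : ℕ) :
    (∏ i ∈ Finset.range m, (2 * (i : ℝ) + 2) / (2 * i + 3)) *
      (∏ i ∈ Finset.range m, (2 * (i : ℝ) + 1) / (2 * i + 2)) = 1 / (2 * m + 1) := by
  induction m with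
  | zero => simp
  | succ m ih =>
    rw [Finset.prod_range_succ, Finset.prod_range_succ, mul_mul_mul_comm, ih]
    push_cast
    field_simp
    ring

theorem integral_sin_pow_two_pi_even (m : ℕ) :
    ∫ φ in (0 : ℝ)..2 * Real.pi, Real.sin φ ^ (2 * m)
      = 2 * ∫ φ in (0 : ℝ)..Real.pi, Real.sin φ ^ (2 * m) := by
  have hint : ∀ a b, IntervalIntegrable (fun φ => Real.sin φ ^ (2 * m)) volume a b := fun a b =>
    (by fun_prop : Continuous fun φ => Real.sin φ ^ (2 * m)).intervalIntegrable _ _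
  rw [← intervalIntegral.integral_add_adjacent_intervals (hint 0 Real.pi) (hint _ _),
    two_mul (∫ φ in (0 : ℝ)..Real.pi, _)]
  congr 1
  have := intervalIntegral.integral_comp_add_right (a := 0) (b := Real.pi)
    (fun φ => Real.sin φ ^ (2 * m)) Real.pi
  rw [zero_add, ← two_mul] at this
  rw [← this]
  simp [Real.sin_add_pi, pow_mul]

theorem integral_sin_pow_two_pi_odd (m : ℕ) :
    ∫ φ in (0 : ℝ)..2 * Real.pi, Real.sin φ ^ (2 * m + 1) = 0 := by
  have hint : ∀ a b, IntervalIntegrable (fun φ => Real.sin φ ^ (2 * m + 1)) volume a b := fun a b =>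
    (by fun_prop : Continuous fun φ => Real.sin φ ^ (2 * m + 1)).intervalIntegrable _ _
  rw [← intervalIntegral.integral_add_adjacent_intervals (hint 0 Real.pi) (hint _ _)]
  have := intervalIntegral.integral_comp_add_right (a := 0) (b := Real.pi)
    (fun φ => Real.sin φ ^ (2 * m + 1)) Real.pi
  rw [zero_add, ← two_mul] at this
  rw [← this]
  simp [Real.sin_add_pi, pow_mul, pow_succ]

theorem sphereInt_pow (k : ℕ) :
    sphereInt (fun ψ φ => (Real.sin ψ * Real.sin φ) ^ k)
      = 2 * Real.pi * ∫ x in (-1 : ℝ)..1, x ^ k := by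
  simp only [sphereInt, mul_pow, intervalIntegral.integral_const_mul]
  rw [integral_pow]
  obtain ⟨m, rfl | rfl⟩ := Nat.even_or_odd' k
  · simp only [← mul_assoc, ← pow_succ']
    rw [intervalIntegral.integral_mul_const, integral_sin_pow_two_pi_even, integral_sin_pow_odd,
      integral_sin_pow_even]
    rw [show ∀ a b : ℝ, 2 * a * (2 * (Real.pi * b)) = 4 * Real.pi * (a * b) by intros; ring,
      prod_mul_prod_wallis]
    simp [pow_succ, pow_mul]
    ring
  · rw [integral_sin_pow_two_pi_odd]
    simp [pow_succ, pow_mul]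

/-- Archimedes' hat-box theorem: the coordinates of a uniform point of the sphere are uniform. -/
theorem sphereInt_comp {h : ℝ → ℝ} (hh : Continuous h) :
    sphereInt (fun ψ φ => h (Real.sin ψ * Real.sin φ)) = 2 * Real.pi * ∫ x in (-1 : ℝ)..1, h x := by
  have poly : ∀ p : Polynomial ℝ, sphereInt (fun ψ φ => p.eval (Real.sin ψ * Real.sin φ))
      = 2 * Real.pi * ∫ x in (-1 : ℝ)..1, p.eval x := by
    intro p
    simp only [Polynomial.eval_eq_sum_range]
    rw [sphereInt_sum, intervalIntegral.integral_finsetSum, Finset.mul_sum]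
    · refine Finset.sum_congr rfl fun i _ => ?_
      rw [sphereInt_const_mul, sphereInt_pow, intervalIntegral.integral_const_mul]; ring
    · intro i _
      exact (by fun_prop : Continuous fun x : ℝ => p.coeff i * x ^ i).intervalIntegrable _ _
    · intro i; fun_prop
  -- Both sides agree on polynomials, hence on uniform limits: an `ε`-approximation costs `4πε` on
  -- the sphere and `4πε` on the interval.
  have key : ∀ ε > 0, |sphereInt (fun ψ φ => h (Real.sin ψ * Real.sin φ))
      - 2 * Real.pi * ∫ x in (-1 : ℝ)..1, h x| ≤ 8 * Real.pi * ε := by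
    intro ε hε
    obtain ⟨p, hp⟩ := exists_polynomial_near_of_continuousOn (-1) 1 h hh.continuousOn ε hε
    have hmem : ∀ ψ φ, Real.sin ψ * Real.sin φ ∈ Set.Icc (-1 : ℝ) 1 := fun ψ φ => by
      rw [Set.mem_Icc, ← abs_le, abs_mul]
      exact mul_le_one₀ (Real.abs_sin_le_one _) (abs_nonneg _) (Real.abs_sin_le_one _)
    have hP : Continuous (Function.uncurry fun ψ φ : ℝ => p.eval (Real.sin ψ * Real.sin φ)) := by
      simp only [Function.uncurry_def]; fun_prop
    have hadd : ∀ c : ℝ, sphereInt (fun ψ φ => p.eval (Real.sin ψ * Real.sin φ) + c)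
        = 2 * Real.pi * (∫ x in (-1 : ℝ)..1, p.eval x) + 4 * Real.pi * c := by
      intro c
      have := sphereInt_sum (Finset.univ : Finset (Fin 2))
        (k := ![fun ψ φ => p.eval (Real.sin ψ * Real.sin φ), fun _ _ => c]) (by
          intro i; fin_cases i
          · exact hP
          · exact continuous_const)
      simpa [Fin.sum_univ_two, poly, sphereInt_const] using this
    have hH : Continuous (Function.uncurry fun ψ φ : ℝ => h (Real.sin ψ * Real.sin φ)) := by
      simp only [Function.uncurry_def]; fun_prop
    have hPc : ∀ c : ℝ, Continuous (Function.uncurry fun ψ φ : ℝ =>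
        p.eval (Real.sin ψ * Real.sin φ) + c) := fun c => by
      simp only [Function.uncurry_def]; fun_prop
    have h1 := sphereInt_mono hH (hPc ε) fun ψ φ => by
      linarith [(abs_lt.1 (hp _ (hmem ψ φ))).1]
    have h2 := sphereInt_mono (hPc (-ε)) hH fun ψ φ => by
      linarith [(abs_lt.1 (hp _ (hmem ψ φ))).2]
    rw [hadd] at h1 h2
    have h3 : |∫ x in (-1 : ℝ)..1, (p.eval x - h x)| ≤ ε * |1 - (-1)| := by
      rw [← Real.norm_eq_abs]
      refine intervalIntegral.norm_integral_le_of_norm_le_const fun x hx => ?_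
      rw [Set.uIoc_of_le (by norm_num)] at hx
      exact (hp x ⟨hx.1.le, hx.2⟩).le
    rw [intervalIntegral.integral_sub ((Polynomial.continuous p).intervalIntegrable _ _)
      (hh.intervalIntegrable _ _), show |(1 : ℝ) - (-1)| = 2 by norm_num, abs_le] at h3
    have hpi := Real.pi_pos
    rw [abs_le]
    constructor <;> nlinarith
  have h0 : ∀ ε > 0, |sphereInt (fun ψ φ => h (Real.sin ψ * Real.sin φ))
      - 2 * Real.pi * ∫ x in (-1 : ℝ)..1, h x| ≤ 0 + ε := by
    intro ε hε
    have := key (ε / (8 * Real.pi)) (by positivity)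
    rw [mul_div_cancel₀ _ (by positivity)] at this
    linarith
  have := abs_nonpos_iff.1 (le_of_forall_pos_le_add h0)
  linarith

theorem sphereInt_rotate {k : ℝ → ℝ → ℝ} (hk : ∀ ψ, Function.Periodic (k ψ) (2 * Real.pi)) (α : ℝ) :
    sphereInt (fun ψ φ => k ψ (φ + α)) = sphereInt k := by
  unfold sphereInt
  congr 1; ext ψ
  rw [intervalIntegral.integral_comp_add_right, zero_add, add_comm]
  rw [(hk ψ).intervalIntegral_add_eq α 0, zero_add]

/-- The average of `f` over the interval with end points `s` and `t` as an integral over the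
sphere. -/
theorem sphereInt_affine {f : ℝ → ℝ} (hf : Continuous f) (s t α : ℝ) :
    sphereInt (fun ψ φ => f ((s + t) / 2 + (t - s) / 2 * (Real.sin ψ * Real.sin (φ + α))))
      = 4 * Real.pi * ∫ u in (0 : ℝ)..1, f (s + (t - s) * u) := by
  rw [sphereInt_rotate (k := fun ψ φ => f ((s + t) / 2 + (t - s) / 2 * (Real.sin ψ * Real.sin φ)))
    (fun ψ φ => by simp)]
  rw [sphereInt_comp (h := fun x => f ((s + t) / 2 + (t - s) / 2 * x)) (by fun_prop)]
  have := intervalIntegral.integral_comp_mul_add (a := 0) (b := 1)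
    (fun x => f ((s + t) / 2 + (t - s) / 2 * x)) (c := 2) two_ne_zero (-1)
  norm_num at this
  have h2 : ∀ x : ℝ, (s + t) / 2 + (t - s) / 2 * (2 * x + -1) = s + (t - s) * x := fun x => by ring
  simp only [h2] at this
  rw [this]; ring

/-! ### Closing polygons -/

/-- Greedy choice: each new term gets the sign opposite to that of the current partial sum. -/
theorem exists_sign_sum_abs_le {ι : Type*} (s : Finset ι) (a : ι → ℝ) {c : ℝ} (hc : 0 ≤ c)
    (ha0 : ∀ i ∈ s, 0 ≤ a i) (ha : ∀ i ∈ s, a i ≤ c) :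
    ∃ ε : ι → Bool, |∑ i ∈ s, (if ε i then a i else -a i)| ≤ c := by
  classical
  induction s using Finset.induction_on with
  | empty => exact ⟨fun _ => true, by simpa using hc⟩
  | insert j s hj ih =>
    obtain ⟨ε, hε⟩ := ih (fun i hi => ha0 i (Finset.mem_insert_of_mem hi))
      fun i hi => ha i (Finset.mem_insert_of_mem hi)
    have h0 := ha0 j (Finset.mem_insert_self _ _)
    have h1 := ha j (Finset.mem_insert_self _ _)
    have hsum : ∀ b : Bool, ∑ i ∈ s, (if Function.update ε j b i then a i else -a i)
        = ∑ i ∈ s, (if ε i then a i else -a i) := fun b =>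
      Finset.sum_congr rfl fun i hi => by
        rw [Function.update_of_ne (ne_of_mem_of_not_mem hi hj)]
    rw [abs_le] at hε
    rcases le_total (∑ i ∈ s, (if ε i then a i else -a i)) 0 with h | h
    · refine ⟨Function.update ε j true, ?_⟩
      rw [Finset.sum_insert hj, Function.update_self, hsum, if_pos rfl, abs_le]
      constructor <;> linarith
    · refine ⟨Function.update ε j false, ?_⟩
      rw [Finset.sum_insert hj, Function.update_self, hsum, if_neg Bool.false_ne_true, abs_le]
      constructor <;> linarith

/-- Side lengths that satisfy the polygon inequality are those of a closed polygon. -/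
theorem exists_angles {ι : Type*} [Fintype ι] (a : ι → ℝ) (ha0 : ∀ i, 0 ≤ a i)
    (ha : ∀ i, 2 * a i ≤ ∑ j, a j) :
    ∃ α : ι → ℝ, ∑ i, (a i : ℂ) * Complex.exp (α i * Complex.I) = 0 := by
  classical
  cases isEmpty_or_nonempty ι
  · exact ⟨fun _ => 0, by simp⟩
  obtain ⟨j, hj⟩ := Finite.exists_max a
  obtain ⟨ε, hε⟩ := exists_sign_sum_abs_le (Finset.univ.erase j) a (ha0 j) (fun i _ => ha0 i)
    fun i _ => hj i
  -- All sides but the longest one, those of negative sign being turned by `θ`. At `θ = 0` they are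
  -- aligned and reach at least `a j`; at `θ = π` they nearly balance and reach at most `a j`. At an
  -- intermediate angle the side `j` closes the polygon.
  let W : ℝ → ℂ := fun θ => ∑ i ∈ Finset.univ.erase j,
    (a i : ℂ) * Complex.exp (((if ε i then 0 else θ : ℝ) : ℂ) * Complex.I)
  have hWc : Continuous fun θ => ‖W θ‖ := by
    refine continuous_norm.comp (continuous_finsetSum _ fun i _ => ?_)
    split_ifs <;> fun_prop
  have hW0 : a j ≤ ‖W 0‖ := by
    have h1 : W 0 = ((∑ i ∈ Finset.univ.erase j, a i : ℝ) : ℂ) := by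
      simp [W]
    rw [h1, Complex.norm_real, Real.norm_eq_abs]
    have := ha j
    rw [← Finset.add_sum_erase _ _ (Finset.mem_univ j)] at this
    exact le_trans (by linarith) (le_abs_self _)
  have hWpi : ‖W Real.pi‖ ≤ a j := by
    have h1 : W Real.pi = ((∑ i ∈ Finset.univ.erase j, (if ε i then a i else -a i) : ℝ) : ℂ) := by
      rw [Complex.ofReal_sum]
      refine Finset.sum_congr rfl fun i _ => ?_
      split_ifs <;> simp
    rwa [h1, Complex.norm_real, Real.norm_eq_abs]
  obtain ⟨θ, -, hθ⟩ := intermediate_value_Icc' Real.pi_pos.le hWc.continuousOn ⟨hWpi, hW0⟩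
  refine ⟨Function.update (fun i => if ε i then 0 else θ) j ((W θ).arg + Real.pi), ?_⟩
  rw [← Finset.add_sum_erase _ _ (Finset.mem_univ j), Function.update_self]
  rw [Finset.sum_congr rfl fun i hi => by
    rw [Function.update_of_ne (Finset.ne_of_mem_erase hi)]]
  change _ + W θ = 0
  have hpolar := Complex.norm_mul_exp_arg_mul_I (W θ)
  simp only at hθ
  rw [hθ] at hpolar
  push_cast
  rw [add_mul, Complex.exp_add, Complex.exp_pi_mul_I]
  linear_combination -hpolar

/-- Uniform laws on intervals whose lengths satisfy the polygon inequality can be coupled such that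
the sum is constant; this is the dual form of that statement. -/
theorem sum_average_nonneg {ι : Type*} [Fintype ι] {T : ℝ} {f : ι → ℝ → ℝ}
    (hf : ∀ i, Continuous (f i))
    (hpos : ∀ x : ι → ℝ, (∀ i, 0 ≤ x i) → ∑ i, x i = T → 0 ≤ ∑ i, f i (x i))
    {s t : ι → ℝ} (hs : ∀ i, 0 ≤ s i) (hst : ∀ i, s i ≤ t i) (hsum : ∑ i, (s i + t i) = 2 * T)
    (hpoly : ∀ i, 2 * (t i - s i) ≤ ∑ j, (t j - s j)) :
    0 ≤ ∑ i, ∫ u in (0 : ℝ)..1, f i (s i + (t i - s i) * u) := by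
  obtain ⟨α, hα⟩ := exists_angles (fun i => (t i - s i) / 2)
    (fun i => by linarith [hst i]) fun i => by
      rw [← Finset.sum_div]; linarith [hpoly i]
  -- Imaginary part of the closed polygon rotated by `φ`. It makes the points with coordinates `(s i
  -- + t i) / 2 + (t i - s i) / 2 * (sin ψ * sin (φ + α i))` sum to `T` for all `ψ`, `φ`.
  have hclose : ∀ φ : ℝ, ∑ i, (t i - s i) / 2 * Real.sin (φ + α i) = 0 := by
    intro φ
    have h1 : (Complex.exp (φ * Complex.I) *
      ∑ i, (((t i - s i) / 2 : ℝ) : ℂ) * Complex.exp (α i * Complex.I)).im = 0 := by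
      rw [hα]; simp
    rw [Finset.mul_sum, Complex.im_sum] at h1
    rw [← h1]
    refine Finset.sum_congr rfl fun i _ => ?_
    rw [mul_left_comm, ← Complex.exp_add, Complex.im_ofReal_mul, ← add_mul, ← Complex.ofReal_add,
      Complex.exp_ofReal_mul_I_im]
  have h1 : sphereInt (fun _ _ => 0) ≤ sphereInt (fun ψ φ => ∑ i,
      f i ((s i + t i) / 2 + (t i - s i) / 2 * (Real.sin ψ * Real.sin (φ + α i)))) := by
    refine sphereInt_mono continuous_const ?_ fun ψ φ => hpos _ (fun i => ?_) ?_
    · simp only [Function.uncurry_def]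
      exact continuous_finsetSum _ fun i _ => (hf i).comp (by fun_prop)
    · have h2 : |Real.sin ψ * Real.sin (φ + α i)| ≤ 1 := by
        rw [abs_mul]
        exact mul_le_one₀ (Real.abs_sin_le_one _) (abs_nonneg _) (Real.abs_sin_le_one _)
      nlinarith [(abs_le.1 h2).1, hst i, hs i]
    · rw [Finset.sum_add_distrib, ← Finset.sum_div, hsum]
      have : ∑ i, (t i - s i) / 2 * (Real.sin ψ * Real.sin (φ + α i))
          = Real.sin ψ * ∑ i, (t i - s i) / 2 * Real.sin (φ + α i) := by
        rw [Finset.mul_sum]; exact Finset.sum_congr rfl fun i _ => by ring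
      rw [this, hclose]; ring
  rw [sphereInt_const, mul_zero, sphereInt_sum] at h1
  · simp only [sphereInt_affine (hf _), ← Finset.mul_sum] at h1
    exact nonneg_of_mul_nonneg_right h1 (by positivity)
  · intro i
    simp only [Function.uncurry_def]
    exact (hf i).comp (by fun_prop)

/-! ### Averages over intervals -/

/-- Average of `f` over the interval with end points `s` and `t`; it is `f s` if `s = t`. -/
noncomputable def avg (f : ℝ → ℝ) (s t : ℝ) : ℝ := ∫ u in (0 : ℝ)..1, f (s + (t - s) * u)

theorem avg_self (f : ℝ → ℝ) (s : ℝ) : avg f s s = f s := by simp [avg]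

theorem continuous_avg {f : ℝ → ℝ} (hf : Continuous f) :
    Continuous fun x : ℝ × ℝ => avg f x.1 x.2 :=
  intervalIntegral.continuous_parametric_intervalIntegral_of_continuous'
    (f := fun (x : ℝ × ℝ) (u : ℝ) => f (x.1 + (x.2 - x.1) * u))
    (by simp only [Function.uncurry_def]; fun_prop) 0 1

theorem mul_avg (f : ℝ → ℝ) (s t : ℝ) : (t - s) * avg f s t = ∫ x in s..t, f x := by
  rw [avg, intervalIntegral.mul_integral_comp_add_mul]; simp

theorem avg_sub_linear {f : ℝ → ℝ} (hf : Continuous f) (κ s t : ℝ) :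
    avg (fun x => f x - 2 * κ * x) s t = avg f s t - κ * (s + t) := by
  unfold avg
  rw [intervalIntegral.integral_sub]
  · have h : ∀ u : ℝ, 2 * κ * (s + (t - s) * u) = 2 * κ * s + (2 * κ * (t - s)) * u :=
      fun u => by ring
    simp only [h]
    rw [intervalIntegral.integral_add, intervalIntegral.integral_const_mul (2 * κ * (t - s)),
      intervalIntegral.integral_const, integral_id]
    · simp; ring
    · exact continuous_const.intervalIntegrable _ _
    · exact (by fun_prop : Continuous fun u : ℝ => 2 * κ * (t - s) * u).intervalIntegrable _ _
  · exact (by fun_prop : Continuous fun u => f (s + (t - s) * u)).intervalIntegrable _ _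
  · exact (by fun_prop : Continuous fun u => 2 * κ * (s + (t - s) * u)).intervalIntegrable _ _

/-- If `t` minimizes the average over `[0, t]`, then the averages over `[s, t]` are not larger. -/
theorem avg_le_of_minimal {f : ℝ → ℝ} (hf : Continuous f) {s t : ℝ} (hs : 0 ≤ s) (hst : s ≤ t)
    (hmin : ∀ u ∈ Set.Icc 0 t, avg f 0 t ≤ avg f 0 u) : avg f s t ≤ avg f 0 t := by
  rcases (hs.trans hst).eq_or_lt with h0 | h0
  · obtain rfl : s = 0 := le_antisymm (by linarith) hs
    exact le_rfl
  -- The average over `[0, t]` is a weighted mean of those over `[0, s]` and `[s, t]`, and the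
  -- former is not smaller. The case `s = t` follows by continuity.
  have hlt : ∀ s ∈ Set.Ico 0 t, avg f s t ≤ avg f 0 t := by
    rintro s ⟨hs, hst⟩
    have h1 := mul_avg f 0 s
    have h2 := mul_avg f s t
    have h3 := mul_avg f 0 t
    rw [← intervalIntegral.integral_add_adjacent_intervals (hf.intervalIntegrable 0 s)
      (hf.intervalIntegrable s t), ← h1, ← h2] at h3
    have h4 := mul_le_mul_of_nonneg_left (hmin s ⟨hs, hst.le⟩) hs
    refine le_of_mul_le_mul_left ?_ (sub_pos.2 hst)
    linarith
  have hclosed : IsClosed {s | avg f s t ≤ avg f 0 t} :=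
    isClosed_le ((continuous_avg hf).comp (by fun_prop : Continuous fun s : ℝ => (s, t)))
      continuous_const
  have := hclosed.closure_subset_iff.2 hlt
  rw [closure_Ico h0.ne] at this
  exact this ⟨hs, hst⟩

/-! ### Minimizers with a common slope -/

section Slope

variable {ι : Type*} [Fintype ι]

/-- Replacing one coordinate of `t'` by that of `t` raises the sum by at most `T`, so going from
`t'` to `t` one coordinate at a time cannot jump over `[T, 2 * T]`. -/
theorem exists_mix_sum_mem {T : ℝ} {t t' : ι → ℝ} (ht : ∀ i, t i ∈ Set.Icc 0 T)
    (ht' : ∀ i, t' i ∈ Set.Icc 0 T) (h : T ≤ ∑ i, t i) (h' : ∑ i, t' i ≤ T) :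
    ∃ w : ι → ℝ, (∀ i, w i = t i ∨ w i = t' i) ∧ T ≤ ∑ i, w i ∧ ∑ i, w i ≤ 2 * T := by
  classical
  by_contra! hcon
  have key : ∀ s : Finset ι, ∑ i, s.piecewise t t' i ≤ T := by
    intro s
    induction s using Finset.induction_on with
    | empty => simpa using h'
    | insert j s hj ih =>
      by_contra! hlt
      have h1 := hcon ((insert j s).piecewise t t') (fun i => by
        by_cases hi : i ∈ insert j s
        · left; exact Finset.piecewise_eq_of_mem _ _ _ hi
        · right; exact Finset.piecewise_eq_of_notMem _ _ _ hi) hlt.le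
      have h2 : ∑ i, (insert j s).piecewise t t' i - ∑ i, s.piecewise t t' i = t j - t' j := by
        rw [← Finset.sum_sub_distrib, Finset.sum_eq_single j]
        · simp [hj]
        · intro i _ hij
          simp [Finset.piecewise, hij]
        · simp
      linarith [(ht j).2, (ht' j).1]
  have h1 := key Finset.univ
  rw [Finset.piecewise_univ] at h1
  have h2 := hcon t (fun i => Or.inl rfl) h
  have h3 : 0 ≤ T := (Finset.sum_nonneg fun i _ => (ht' i).1).trans h'
  linarith

/-- There are minimizers of the functions `F i - κ t` on `[0, T]` whose sum is between `T` and
`2 * T`, for some slope `κ`. -/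
theorem exists_slope (hn : 2 ≤ Fintype.card ι) {T : ℝ} (hT : 0 < T) {F : ι → ℝ → ℝ}
    (hF : ∀ i, Continuous (F i)) :
    ∃ (κ : ℝ) (t : ι → ℝ), (∀ i, t i ∈ Set.Icc 0 T) ∧
      (∀ i, ∀ u ∈ Set.Icc 0 T, F i (t i) - κ * t i ≤ F i u - κ * u) ∧
      T ≤ ∑ i, t i ∧ ∑ i, t i ≤ 2 * T := by
  let Q : Set (ι → ℝ) := Set.pi Set.univ fun _ => Set.Icc 0 T
  have hQ : IsCompact Q := isCompact_univ_pi fun _ => isCompact_Icc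
  let A : Set (ℝ × (ι → ℝ)) :=
    {x | ∀ i, ∀ u ∈ Set.Icc 0 T, F i (x.2 i) - x.1 * x.2 i ≤ F i u - x.1 * u}
  have hA : IsClosed A := by
    simp only [A, Set.ofPred_forall]
    exact isClosed_iInter fun i => isClosed_iInter fun u => isClosed_iInter fun _ =>
      isClosed_le (by fun_prop) (by fun_prop)
  have hne : ∀ κ, ∃ t ∈ Q, (κ, t) ∈ A := by
    intro κ
    have : ∀ i, ∃ t ∈ Set.Icc 0 T, IsMinOn (fun t => F i t - κ * t) (Set.Icc 0 T) t := fun i =>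
      isCompact_Icc.exists_isMinOn (Set.nonempty_Icc.2 hT.le) (by fun_prop)
    choose t ht hmin using this
    exact ⟨t, fun i _ => ht i, fun i u hu => hmin i hu⟩
  obtain ⟨M, hM⟩ : ∃ M, ∀ i, ∀ u ∈ Set.Icc 0 T, |F i u| ≤ M := by
    have : ∀ i, ∃ M, ∀ u ∈ Set.Icc 0 T, |F i u| ≤ M := fun i =>
      isCompact_Icc.exists_bound_of_continuousOn (hF i).continuousOn
    choose M hM using this
    exact ⟨∑ i, |M i|, fun i u hu => (hM i u hu).trans ((le_abs_self _).trans
      (Finset.single_le_sum (f := fun i => |M i|) (fun _ _ => abs_nonneg _) (Finset.mem_univ i)))⟩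
  set N : ℝ := (Fintype.card ι : ℝ) with hN
  have hN2 : (2 : ℝ) ≤ N := by rw [hN]; exact_mod_cast hn
  have h0 : (0 : ℝ) ∈ Set.Icc 0 T := ⟨le_rfl, hT.le⟩
  have h1 : T ∈ Set.Icc 0 T := ⟨hT.le, le_rfl⟩
  have hM0 : 0 ≤ M := by
    have : Nonempty ι := Fintype.card_pos_iff.1 (by omega)
    exact (abs_nonneg _).trans (hM (Classical.arbitrary ι) 0 h0)
  -- Since `|F i| ≤ M`, at slope `±(c + 1)` the distances of the minimizers from the favoured end of
  -- `[0, T]` add up to at most `2 * N * M / (c + 1)`, which is less than `T`.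
  set c : ℝ := 2 * N * M / T with hc
  have hcT : c * T = 2 * N * M := by rw [hc]; field_simp
  have hc0 : 0 ≤ c := by positivity
  have hlow : ∀ t ∈ Q, (-(c + 1), t) ∈ A → ∑ i, t i ≤ T := by
    intro t ht hAt
    have h2 : ∑ i, (c + 1) * t i ≤ ∑ _i : ι, 2 * M := Finset.sum_le_sum fun i _ => by
      have := hAt i 0 h0
      simp only at this
      linarith [(abs_le.1 (hM i (t i) (ht i trivial))).1, (abs_le.1 (hM i 0 h0)).2]
    rw [← Finset.mul_sum, Finset.sum_const, Finset.card_univ, nsmul_eq_mul, ← hN] at h2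
    nlinarith
  -- The sum of the minimizers exceeds `(N - 1) * T`, which is at least `T` because there are at
  -- least two indices.
  have hhigh : ∀ t ∈ Q, (c + 1, t) ∈ A → T ≤ ∑ i, t i := by
    intro t ht hAt
    have h2 : ∑ i, (c + 1) * (T - t i) ≤ ∑ _i : ι, 2 * M := Finset.sum_le_sum fun i _ => by
      have := hAt i T h1
      simp only at this
      linarith [(abs_le.1 (hM i (t i) (ht i trivial))).1, (abs_le.1 (hM i T h1)).2]
    rw [← Finset.mul_sum, Finset.sum_sub_distrib, Finset.sum_const, Finset.sum_const,
      Finset.card_univ, nsmul_eq_mul, nsmul_eq_mul, ← hN] at h2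
    by_contra! hlt
    have h3 : (c + 1) * T ≤ (c + 1) * (N * T - ∑ i, t i) :=
      mul_le_mul_of_nonneg_left (by nlinarith) (by linarith)
    linarith
  let S : Set ℝ := Set.Icc (-(c + 1)) (c + 1)
  have hproj : ∀ B : Set (ι → ℝ), IsClosed B →
      IsClosed (Prod.fst '' (A ∩ S ×ˢ (Q ∩ B))) := fun B hB =>
    (((isCompact_Icc.prod (hQ.inter_right hB)).inter_left hA).image continuous_fst).isClosed
  have hsum : Continuous fun t : ι → ℝ => ∑ i, t i := by fun_prop
  have hS : (-(c + 1)) ∈ S ∧ c + 1 ∈ S := ⟨⟨le_rfl, by linarith⟩, ⟨by linarith, le_rfl⟩⟩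
  -- The slopes having minimizers of sum at least `T`, and those having minimizers of sum at most
  -- `T`, form two nonempty closed sets that cover the interval `S`. By connectedness they share a
  -- slope; mixing its two families of minimizers coordinatewise puts the sum in `[T, 2 * T]`.
  obtain ⟨κ, -, ⟨⟨κ', t⟩, ⟨hAt, -, htQ, ht⟩, rfl⟩, ⟨⟨κ'', t'⟩, ⟨hAt', -, htQ', ht'⟩, hκ⟩⟩ :=
    isPreconnected_closed_iff.1 (isPreconnected_Icc : IsPreconnected S) _ _
      (hproj _ (isClosed_le continuous_const hsum : IsClosed {t : ι → ℝ | T ≤ ∑ i, t i}))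
      (hproj _ (isClosed_le hsum continuous_const : IsClosed {t : ι → ℝ | ∑ i, t i ≤ T}))
      (fun κ hκ => by
        obtain ⟨t, htQ, hAt⟩ := hne κ
        rcases le_total T (∑ i, t i) with h | h
        · exact Or.inl ⟨(κ, t), ⟨hAt, hκ, htQ, h⟩, rfl⟩
        · exact Or.inr ⟨(κ, t), ⟨hAt, hκ, htQ, h⟩, rfl⟩)
      (by
        obtain ⟨t, htQ, hAt⟩ := hne (c + 1)
        exact ⟨c + 1, hS.2, (c + 1, t), ⟨hAt, hS.2, htQ, hhigh t htQ hAt⟩, rfl⟩)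
      (by
        obtain ⟨t, htQ, hAt⟩ := hne (-(c + 1))
        exact ⟨-(c + 1), hS.1, (-(c + 1), t), ⟨hAt, hS.1, htQ, hlow t htQ hAt⟩, rfl⟩)
  simp only at hκ
  subst hκ
  obtain ⟨w, hw, hw1, hw2⟩ := exists_mix_sum_mem (fun i => htQ i trivial)
    (fun i => htQ' i trivial) ht ht'
  refine ⟨κ'', w, fun i => ?_, fun i => ?_, hw1, hw2⟩
  · rcases hw i with h | h <;> rw [h]
    exacts [htQ i trivial, htQ' i trivial]
  · rcases hw i with h | h <;> rw [h]
    exacts [hAt i, hAt' i]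

/-- The `s i` must add up to `D = 2 * T - ∑ i, t i`. The lengths then add up to `2 * (T - D)`, so
the polygon inequality reads `s i ≥ D + t i - T`. Vectors between these lower bounds `l` and `t`
attain the sum `D` as soon as `∑ l ≤ D ≤ ∑ t`. -/
theorem exists_lower_ends {T : ℝ} {t : ι → ℝ} (ht : ∀ i, t i ∈ Set.Icc 0 T)
    (h1 : T ≤ ∑ i, t i) (h2 : ∑ i, t i ≤ 2 * T) :
    ∃ s : ι → ℝ, (∀ i, 0 ≤ s i) ∧ (∀ i, s i ≤ t i) ∧ ∑ i, (s i + t i) = 2 * T ∧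
      ∀ i, 2 * (t i - s i) ≤ ∑ j, (t j - s j) := by
  classical
  set D := 2 * T - ∑ i, t i with hD
  let l : ι → ℝ := fun i => max 0 (D + t i - T)
  have hl0 : ∀ i, 0 ≤ l i := fun i => le_max_left _ _
  have hlt : ∀ i, l i ≤ t i := fun i => max_le (ht i).1 (by linarith)
  have hlD : ∑ i, l i ≤ D := by
    set K := Finset.univ.filter fun i => 0 < D + t i - T with hK
    have e : ∑ i, l i = ∑ i ∈ K, (D + t i - T) := by
      rw [hK, Finset.sum_filter]
      refine Finset.sum_congr rfl fun i _ => ?_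
      split_ifs with h
      · exact max_eq_right h.le
      · exact max_eq_left (not_lt.1 h)
    rw [e]
    have hKt : ∑ i ∈ K, t i ≤ ∑ i, t i :=
      Finset.sum_le_sum_of_subset_of_nonneg (Finset.subset_univ _) fun i _ _ => (ht i).1
    -- With at most one positive bound, `D ≥ 0` and `t i ≤ T` suffice. With two or more, `D ≤ T`
    -- gives at most `2 * (D - T) + ∑ i, t i = D`.
    rcases Nat.lt_or_ge K.card 2 with h | h
    · interval_cases hc : K.card
      · rw [Finset.card_eq_zero.1 hc]; simp; linarith
      · obtain ⟨i, hi⟩ := Finset.card_eq_one.1 hc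
        rw [hi, Finset.sum_singleton]; linarith [(ht i).2]
    · have h' : (2 : ℝ) ≤ K.card := by exact_mod_cast h
      have : ∑ i ∈ K, (D + t i - T) = K.card * (D - T) + ∑ i ∈ K, t i := by
        rw [← nsmul_eq_mul, ← Finset.sum_const, ← Finset.sum_add_distrib]
        exact Finset.sum_congr rfl fun i _ => by ring
      rw [this]
      nlinarith
  have hDt : D ≤ ∑ i, t i := by linarith
  obtain ⟨x, ⟨hx0, hx1⟩, hx⟩ : D ∈ (fun x : ℝ => ∑ i, (l i + x * (t i - l i))) '' Set.Icc 0 1 :=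
    intermediate_value_Icc zero_le_one
      (by fun_prop : Continuous fun x : ℝ => ∑ i, (l i + x * (t i - l i))).continuousOn
      ⟨by simpa using hlD, by simpa using hDt⟩
  simp only at hx
  have hls : ∀ i, l i ≤ l i + x * (t i - l i) := fun i => by nlinarith [hlt i]
  refine ⟨fun i => l i + x * (t i - l i), fun i => (hl0 i).trans (hls i),
    fun i => by nlinarith [hlt i], ?_, fun i => ?_⟩
  · rw [Finset.sum_add_distrib, hx]; ring
  · rw [Finset.sum_sub_distrib, hx]
    have := le_max_right 0 (D + t i - T)
    have := hls i
    linarith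

/-- Dual form of the statement that the laws `(1 - p i) δ₀ + p i Unif[0, b i]` can be coupled such
that the sum is the constant `T`. -/
theorem sum_zeroUnif_nonneg (hn : 2 ≤ Fintype.card ι) {T : ℝ} (hT : 0 < T) {f : ι → ℝ → ℝ}
    (hf : ∀ i, Continuous (f i))
    (hpos : ∀ x : ι → ℝ, (∀ i, 0 ≤ x i) → ∑ i, x i = T → 0 ≤ ∑ i, f i (x i))
    {p b : ι → ℝ} (hp : ∀ i, p i ∈ Set.Icc 0 1) (hb : ∀ i, b i ∈ Set.Icc 0 T)
    (hpb : ∑ i, p i * b i = 2 * T) :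
    0 ≤ ∑ i, ((1 - p i) * f i 0 + p i * avg (f i) 0 (b i)) := by
  obtain ⟨κ, t, ht, hmin, h1, h2⟩ := exists_slope hn hT (F := fun i t => avg (f i) 0 t)
    fun i => (continuous_avg (hf i)).comp (by fun_prop : Continuous fun t : ℝ => ((0 : ℝ), t))
  obtain ⟨s, hs0, hst, hsum, hpoly⟩ := exists_lower_ends ht h1 h2
  have key : 0 ≤ ∑ i, avg (f i) (s i) (t i) := sum_average_nonneg hf hpos hs0 hst hsum hpoly
  -- The average of `f i x - 2 * κ * x` over `[0, u]` is `F i u - κ * u`, which `t i` minimizes.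
  have hle : ∀ i, avg (f i) (s i) (t i) - κ * (s i + t i) ≤ avg (f i) 0 (t i) - κ * t i := by
    intro i
    have := avg_le_of_minimal (f := fun x => f i x - 2 * κ * x) (by have := hf i; fun_prop)
      (hs0 i) (hst i) fun u hu => by
        rw [avg_sub_linear (hf i), avg_sub_linear (hf i), zero_add, zero_add]
        exact hmin i u ⟨hu.1, hu.2.trans (ht i).2⟩
    rwa [avg_sub_linear (hf i), avg_sub_linear (hf i), zero_add] at this
  -- The minimum is compared with the values at `0` and `b i`, weighted by `1 - p i` and `p i`.
  -- After summation the terms in `κ` cancel, both totals being `2 * T`.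
  have hle' : ∀ i, avg (f i) (s i) (t i) - κ * (s i + t i) + κ * (p i * b i)
      ≤ (1 - p i) * f i 0 + p i * avg (f i) 0 (b i) := by
    intro i
    have e1 := hmin i 0 ⟨le_rfl, hT.le⟩
    have e2 := hmin i (b i) (hb i)
    simp only [avg_self] at e1
    nlinarith [hle i, mul_le_mul_of_nonneg_left e2 (hp i).1,
      mul_le_mul_of_nonneg_left e1 (sub_nonneg.2 (hp i).2)]
  have := Finset.sum_le_sum fun i (_ : i ∈ Finset.univ) => hle' i
  rw [Finset.sum_add_distrib, Finset.sum_sub_distrib, ← Finset.mul_sum, ← Finset.mul_sum, hsum,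
    hpb] at this
  linarith

end Slope

/-! ### Duality for couplings -/

open CompactlySupported in
/-- Duality for couplings of finitely many laws that are supported on a compact set `K`. -/
theorem exists_coupling_of_dual {ι : Type*} [Fintype ι] [Nonempty ι] {K : Set (ι → ℝ)}
    (hK : IsCompact K) {μ : ι → Measure ℝ} [∀ i, IsFiniteMeasure (μ i)]
    (hint : ∀ i, ∀ f : ℝ → ℝ, Continuous f → Integrable f (μ i))
    (hdual : ∀ f : ι → ℝ → ℝ, (∀ i, Continuous (f i)) → (∀ x ∈ K, 0 ≤ ∑ i, f i (x i)) →
      0 ≤ ∑ i, ∫ x, f i x ∂μ i) :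
    ∃ π : Measure (ι → ℝ), (∀ i, π.map (fun x => x i) = μ i) ∧ ∀ᵐ x ∂π, x ∈ K := by
  classical
  have : CompactSpace K := isCompact_iff_compactSpace.1 hK
  let E := (ι → C(ℝ, ℝ)) × C_c(K, ℝ)
  -- The pairs `(f, g)` with `∑ i, f i (x i) + g x ≥ 0` on `K`. By `hdual` the prescribed
  -- expectations are nonnegative on the part of the cone with `g = 0`. A positive extension to all
  -- pairs, restricted to `f = 0`, is a positive functional of `g` and hence a measure on `K`.
  let s : PointedCone ℝ E :=
    { carrier := {y | ∀ x : K, 0 ≤ ∑ i, y.1 i (x.1 i) + y.2 x}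
      add_mem' := fun {y z} hy hz x => by
        have := add_nonneg (hy x) (hz x)
        have e : ∑ i, (y + z).1 i (x.1 i) + (y + z).2 x = (∑ i, y.1 i (x.1 i) + y.2 x) +
            (∑ i, z.1 i (x.1 i) + z.2 x) := by
          rw [add_add_add_comm, ← Finset.sum_add_distrib]; rfl
        rw [e]; exact this
      zero_mem' := fun x => by simp
      smul_mem' := fun c y hy x => by
        have := mul_nonneg c.2 (hy x)
        have e : ∑ i, (c • y).1 i (x.1 i) + (c • y).2 x
            = (c : ℝ) * (∑ i, y.1 i (x.1 i) + y.2 x) := by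
          rw [mul_add, Finset.mul_sum]; rfl
        rw [e]; exact this }
  let ℓ : (ι → C(ℝ, ℝ)) →ₗ[ℝ] ℝ :=
    { toFun := fun f => ∑ i, ∫ x, f i x ∂μ i
      map_add' := fun f g => by
        rw [← Finset.sum_add_distrib]
        exact Finset.sum_congr rfl fun i _ =>
          integral_add (hint i _ (f i).continuous) (hint i _ (g i).continuous)
      map_smul' := fun c f => by
        simp only [RingHom.id_apply, smul_eq_mul, Finset.mul_sum]
        exact Finset.sum_congr rfl fun i _ => integral_const_mul _ _ }
  let dom : Submodule ℝ E := LinearMap.ker (LinearMap.snd ℝ (ι → C(ℝ, ℝ)) C_c(K, ℝ))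
  obtain ⟨Φ, hΦ, hΦs⟩ := riesz_extension s
    ⟨dom, (ℓ ∘ₗ LinearMap.fst ℝ (ι → C(ℝ, ℝ)) C_c(K, ℝ)) ∘ₗ dom.subtype⟩
    (by
      rintro ⟨⟨f, g⟩, hg⟩ hs
      obtain rfl : g = 0 := hg
      refine hdual (fun i => f i) (fun i => (f i).continuous) fun x hx => ?_
      simpa using hs ⟨x, hx⟩)
    (by
      rintro ⟨f, g⟩
      obtain ⟨M, hM⟩ := (isCompact_univ (X := K)).exists_bound_of_continuousOn
        (f := fun x => g x) g.continuous.continuousOn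
      -- Cofinality of the subspace: adding this element leaves constants that dominate `g`.
      refine ⟨⟨(fun i => ContinuousMap.const ℝ |M| - f i, 0), rfl⟩, fun x => ?_⟩
      have h1 := (abs_le.1 (hM x trivial)).1
      have h2 : |M| ≤ ∑ _i : ι, |M| :=
        Finset.single_le_sum (f := fun _ : ι => |M|) (fun _ _ => abs_nonneg M)
          (Finset.mem_univ (Classical.arbitrary ι))
      have h3 := le_abs_self M
      have e : ∀ i, |M| - f i (x.1 i) + f i (x.1 i) = |M| := fun i => sub_add_cancel _ _
      change 0 ≤ ∑ i, (|M| - f i (x.1 i) + f i (x.1 i)) + (0 + g x)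
      simp only [e]
      linarith)
  let L : C_c(K, ℝ) →ₚ[ℝ] ℝ := PositiveLinearMap.mk₀
    (Φ ∘ₗ LinearMap.inr ℝ (ι → C(ℝ, ℝ)) C_c(K, ℝ)) fun g hg => hΦs _ fun x => by
      change 0 ≤ ∑ _i : ι, (0 : ℝ) + g x
      simpa using hg x
  let ν := RealRMK.rieszMeasure L
  have hL : ∀ (j : ι) (f : C(ℝ, ℝ)), ∫ x : K, f (x.1 j) ∂ν = ∫ x, f x ∂μ j := by
    intro j f
    let g : C_c(K, ℝ) := CompactlySupportedContinuousMap.continuousMapEquiv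
      ⟨fun x : K => f (x.1 j), f.continuous.comp ((continuous_apply j).comp continuous_subtype_val)⟩
    have h1 : ∫ x : K, f (x.1 j) ∂ν = Φ (0, g) := RealRMK.integral_rieszMeasure L g
    have h2 : Φ (Pi.single j f, 0) = ∫ x, f x ∂μ j := by
      rw [hΦ ⟨(Pi.single j f, 0), rfl⟩]
      change ∑ i, ∫ x, (Pi.single j f : ι → C(ℝ, ℝ)) i x ∂μ i = _
      rw [Finset.sum_eq_single j]
      · simp
      · intro i _ hij
        simp [Pi.single_eq_of_ne hij]
      · simp
    have hsum : ∀ x : K, ∑ i, (Pi.single j f : ι → C(ℝ, ℝ)) i (x.1 i) = f (x.1 j) := by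
      intro x
      rw [Finset.sum_eq_single j]
      · simp
      · intro i _ hij
        simp [Pi.single_eq_of_ne hij]
      · simp
    have hg : ∀ x : K, g x = f (x.1 j) := fun x => rfl
    -- The pair `(Pi.single j f, -g)` sums to zero on `K`, so it and its negative lie in the cone
    -- and `Φ` vanishes there. This identifies the `j`-th marginal.
    have h3 : 0 ≤ Φ (Pi.single j f, -g) := hΦs _ fun x => by
      change 0 ≤ ∑ i, (Pi.single j f : ι → C(ℝ, ℝ)) i (x.1 i) + (-g) x
      rw [hsum, CompactlySupportedContinuousMap.neg_apply, hg]; simp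
    have h4 : 0 ≤ Φ (-(Pi.single j f, -g)) := hΦs _ fun x => by
      change 0 ≤ ∑ i, (-(Pi.single j f : ι → C(ℝ, ℝ))) i (x.1 i) + (-(-g)) x
      simp only [Pi.neg_apply, ContinuousMap.neg_apply, Finset.sum_neg_distrib, hsum, neg_neg, hg]
      simp
    have h5 : ((Pi.single j f, -g) : E) = (Pi.single j f, 0) - (0, g) := by simp
    rw [map_neg] at h4
    have h6 := le_antisymm (neg_nonneg.1 h4) h3
    rw [h5, map_sub, h2, ← h1] at h6
    linarith
  refine ⟨ν.map Subtype.val, fun j => ?_, ?_⟩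
  · rw [Measure.map_map (measurable_pi_apply j) measurable_subtype_coe]
    refine ext_of_forall_integral_eq_of_IsFiniteMeasure fun f => ?_
    rw [integral_map ((measurable_pi_apply j).comp measurable_subtype_coe).aemeasurable
      f.continuous.aestronglyMeasurable]
    exact hL j f.toContinuousMap
  · refine (ae_map_iff measurable_subtype_coe.aemeasurable hK.isClosed.measurableSet).2 ?_
    exact Filter.Eventually.of_forall fun x => x.2

/-! ### Zero-inflated uniform laws -/

theorem unif_eq {b : ℝ} :
    unif b = (ENNReal.ofReal b)⁻¹ • volume.restrict (Set.Icc 0 b) := by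
  rw [unif, ProbabilityTheory.cond, Real.volume_Icc, sub_zero]

theorem isProbabilityMeasure_unif {b : ℝ} (hb : 0 < b) : IsProbabilityMeasure (unif b) := by
  exact cond_isProbabilityMeasure_of_finite (by simp [hb]) (by simp)

theorem integrable_unif {b : ℝ} (hb : 0 < b) {f : ℝ → ℝ} (hf : Continuous f) :
    Integrable f (unif b) := by
  rw [unif_eq]
  exact (hf.continuousOn.integrableOn_compact isCompact_Icc).smul_measure (by simp [hb])

theorem integral_unif {b : ℝ} (hb : 0 < b) (f : ℝ → ℝ) :
    ∫ x, f x ∂unif b = avg f 0 b := by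
  rw [unif_eq, integral_smul_measure, integral_Icc_eq_integral_Ioc,
    ← intervalIntegral.integral_of_le hb.le, ← mul_avg, ENNReal.toReal_inv,
    ENNReal.toReal_ofReal hb.le, smul_eq_mul]
  field_simp
  ring

theorem Icc_inter_Iic_of_le {a b x : ℝ} (h : x ≤ b) :
    Set.Icc a b ∩ Set.Iic x = Set.Icc a x := by
  ext y; simp only [Set.mem_inter_iff, Set.mem_Icc, Set.mem_Iic]
  exact ⟨fun hy => ⟨hy.1.1, hy.2⟩, fun hy => ⟨⟨hy.1, hy.2.trans h⟩, hy.2⟩⟩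

theorem unif_real_Iic {b x : ℝ} (hb : 0 < b) (hx0 : 0 ≤ x) (hxb : x ≤ b) :
    (unif b).real (Set.Iic x) = x / b := by
  rw [unif_eq, Measure.real, Measure.smul_apply, Measure.restrict_apply measurableSet_Iic,
    Set.inter_comm, Icc_inter_Iic_of_le hxb, Real.volume_Icc, sub_zero, smul_eq_mul,
    ENNReal.toReal_mul, ENNReal.toReal_inv, ENNReal.toReal_ofReal hb.le, ENNReal.toReal_ofReal hx0]
  field_simp

theorem unif_singleton (b x : ℝ) : unif b {x} = 0 := by
  rw [unif_eq, Measure.smul_apply, Measure.restrict_apply (measurableSet_singleton x)]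
  simp [measure_mono_null Set.inter_subset_left]

theorem unif_eq_zeroUnif (b : ℝ) : unif b = zeroUnif 1 b := by simp [zeroUnif]

theorem isProbabilityMeasure_zeroUnif {p b : ℝ} (hp0 : 0 ≤ p) (hp1 : p ≤ 1) (hb : 0 < b) :
    IsProbabilityMeasure (zeroUnif p b) := by
  have := isProbabilityMeasure_unif hb
  refine ⟨?_⟩
  rw [zeroUnif, Measure.add_apply, Measure.smul_apply, Measure.smul_apply, measure_univ,
    measure_univ, smul_eq_mul, smul_eq_mul, mul_one, mul_one,
    ← ENNReal.ofReal_add (by linarith) hp0]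
  simp

theorem integrable_zeroUnif {p b : ℝ} (hb : 0 < b) {f : ℝ → ℝ} (hf : Continuous f) :
    Integrable f (zeroUnif p b) :=
  ((integrable_dirac (by simp)).smul_measure (by simp)).add_measure
    ((integrable_unif hb hf).smul_measure (by simp))

theorem integral_zeroUnif {p b : ℝ} (hp0 : 0 ≤ p) (hp1 : p ≤ 1) (hb : 0 < b) {f : ℝ → ℝ}
    (hf : Continuous f) :
    ∫ x, f x ∂zeroUnif p b = (1 - p) * f 0 + p * avg f 0 b := by
  rw [zeroUnif, integral_add_measure ((integrable_dirac (by simp)).smul_measure (by simp))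
    ((integrable_unif hb hf).smul_measure (by simp)), integral_smul_measure, integral_smul_measure,
    integral_dirac, integral_unif hb, ENNReal.toReal_ofReal (by linarith), ENNReal.toReal_ofReal hp0]
  rfl

theorem integral_id_zeroUnif {p b : ℝ} (hp0 : 0 ≤ p) (hp1 : p ≤ 1) (hb : 0 < b) :
    ∫ x, x ∂zeroUnif p b = p * b / 2 := by
  have h := mul_avg (fun x => x) 0 b
  rw [integral_id, sub_zero] at h
  have h2 : avg (fun x => x) 0 b = b / 2 := mul_left_cancel₀ hb.ne' (by rw [h]; ring)
  rw [integral_zeroUnif hp0 hp1 hb (f := fun x => x) continuous_id, h2]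
  ring

theorem zeroUnif_compl_Icc (p : ℝ) {b : ℝ} (hb : 0 < b) :
    zeroUnif p b (Set.Icc 0 b)ᶜ = 0 := by
  rw [zeroUnif, unif_eq]
  simp [hb.le]

theorem zeroUnif_singleton {p b x : ℝ} (h : p = 1 ∨ x ≠ 0) : zeroUnif p b {x} = 0 := by
  rw [zeroUnif, Measure.add_apply, Measure.smul_apply, Measure.smul_apply, unif_singleton]
  rcases h with rfl | h
  · simp
  · simp [h.symm]

/-- The distribution function of a zero-inflated uniform law. -/
theorem zeroUnif_real_Iic {p b x : ℝ} (hp0 : 0 ≤ p) (hp1 : p ≤ 1) (hb : 0 < b) (hx0 : 0 ≤ x)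
    (hxb : x ≤ b) : (zeroUnif p b).real (Set.Iic x) = 1 - p + p * (x / b) := by
  have := isProbabilityMeasure_unif hb
  rw [zeroUnif, measureReal_add_apply (ENNReal.mul_ne_top (by simp) (measure_ne_top _ _))
    (ENNReal.mul_ne_top (by simp) (measure_ne_top _ _)), measureReal_ennreal_smul_apply,
    measureReal_ennreal_smul_apply, unif_real_Iic hb hx0 hxb, ENNReal.toReal_ofReal (by linarith),
    ENNReal.toReal_ofReal hp0]
  simp [Measure.real, hx0]

/-- Zero-inflated uniform laws can be coupled such that the sum is constant. -/
theorem exists_zeroUnif_coupling {n : ℕ} (hn : 2 ≤ n) {T : ℝ} (hT : 0 < T) {p b : Fin n → ℝ}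
    (hp : ∀ i, p i ∈ Set.Icc 0 1) (hb0 : ∀ i, 0 < b i) (hbT : ∀ i, b i ≤ T)
    (hpb : ∑ i, p i * b i = 2 * T) :
    ∃ π : Measure (Fin n → ℝ), IsCoupling (fun i => zeroUnif (p i) (b i)) π ∧
      ∀ᵐ x ∂π, (∀ i, 0 ≤ x i) ∧ ∑ i, x i = T := by
  have : Nonempty (Fin n) := ⟨⟨0, by omega⟩⟩
  have := fun i => isProbabilityMeasure_zeroUnif (hp i).1 (hp i).2 (hb0 i)
  have hK : IsCompact {x : Fin n → ℝ | (∀ i, 0 ≤ x i) ∧ ∑ i, x i = T} := by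
    refine (isCompact_univ_pi fun _ => isCompact_Icc (a := (0 : ℝ)) (b := T)).of_isClosed_subset
      ?_ fun x hx i _ => ⟨hx.1 i, ?_⟩
    · simp only [Set.ofPred_and, Set.ofPred_forall]
      exact (isClosed_iInter fun i => isClosed_le continuous_const (continuous_apply i)).inter
        (isClosed_eq (by fun_prop) continuous_const)
    · rw [← hx.2]
      exact Finset.single_le_sum (fun i _ => hx.1 i) (Finset.mem_univ i)
  obtain ⟨π, hπ, hπK⟩ := exists_coupling_of_dual hK (μ := fun i => zeroUnif (p i) (b i))
    (fun i f hf => integrable_zeroUnif (hb0 i) hf) fun f hf hpos => by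
      simp only [integral_zeroUnif (hp _).1 (hp _).2 (hb0 _) (hf _)]
      exact sum_zeroUnif_nonneg (by simpa using hn) hT hf (fun x h0 hx => hpos x ⟨h0, hx⟩) hp
        (fun i => ⟨(hb0 i).le, hbT i⟩) hpb
  exact ⟨π, hπ, hπK⟩

variable {n : ℕ}

/-! ### Exchanging the players -/

/-- The tie-breaking rule with exchanged players. -/
def TieRule.swap (τ : TieRule n) : TieRule n where
  shareA x y := τ.shareB y x
  shareB x y := τ.shareA y x
  shareA_nonneg x y := τ.shareB_nonneg y x
  shareB_nonneg x y := τ.shareA_nonneg y x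
  share_add_le_one x y i := by rw [add_comm]; exact τ.share_add_le_one y x i
  measurable_shareA i := (τ.measurable_shareB i).comp measurable_swap
  measurable_shareB i := (τ.measurable_shareA i).comp measurable_swap

theorem payoffA_swap (τ : TieRule n) (v x y : Fin n → ℝ) :
    payoffA τ.swap v y x = payoffB τ v x y := by
  simp only [payoffA, payoffB, TieRule.swap, eq_comm]

theorem utilityA_swap (τ : TieRule n) (v : Fin n → ℝ) (πA πB : Measure (Fin n → ℝ)) [SFinite πA]
    [SFinite πB] : utilityA τ.swap v πB πA = utilityB τ v πA πB := by
  rw [utilityA, utilityB, ← integral_prod_swap]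
  simp only [Prod.fst_swap, Prod.snd_swap, payoffA_swap]

/-! ### Payoffs -/

theorem TieRule.shareA_le_one (τ : TieRule n) (x y : Fin n → ℝ) (i : Fin n) :
    τ.shareA x y i ≤ 1 := by
  linarith [τ.shareB_nonneg x y i, τ.share_add_le_one x y i]

theorem measurable_payoffA (τ : TieRule n) (v : Fin n → ℝ) :
    Measurable fun p : (Fin n → ℝ) × (Fin n → ℝ) => payoffA τ v p.1 p.2 := by
  refine Finset.measurable_sum _ fun i _ => measurable_const.mul ?_
  have hx : Measurable fun p : (Fin n → ℝ) × (Fin n → ℝ) => p.1 i :=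
    (measurable_pi_apply i).comp measurable_fst
  have hy : Measurable fun p : (Fin n → ℝ) × (Fin n → ℝ) => p.2 i :=
    (measurable_pi_apply i).comp measurable_snd
  exact Measurable.ite (measurableSet_lt hy hx) measurable_const
    (Measurable.ite (measurableSet_eq_fun hx hy) (τ.measurable_shareA i) measurable_const)

theorem payoffA_le (τ : TieRule n) {v : Fin n → ℝ} (hv : ∀ i, 0 ≤ v i) (x y : Fin n → ℝ) :
    payoffA τ v x y ≤ ∑ i, v i * (if y i ≤ x i then 1 else 0) := by
  refine Finset.sum_le_sum fun i _ => mul_le_mul_of_nonneg_left ?_ (hv i)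
  split_ifs with h1 h2 h3 h4 h5
  · exact le_rfl
  · exact absurd h1.le h2
  · exact τ.shareA_le_one x y i
  · exact absurd h3.ge h4
  · exact zero_le_one
  · exact le_rfl

theorem le_payoffA (τ : TieRule n) {v : Fin n → ℝ} (hv : ∀ i, 0 ≤ v i) (x y : Fin n → ℝ) :
    ∑ i, v i * (if y i < x i then 1 else 0) ≤ payoffA τ v x y := by
  refine Finset.sum_le_sum fun i _ => mul_le_mul_of_nonneg_left ?_ (hv i)
  split_ifs with h1 h2
  · exact le_rfl
  · exact τ.shareA_nonneg x y i
  · exact le_rfl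

theorem abs_payoffA_le (τ : TieRule n) {v : Fin n → ℝ} (hv : ∀ i, 0 ≤ v i) (x y : Fin n → ℝ) :
    |payoffA τ v x y| ≤ ∑ i, v i := by
  rw [abs_of_nonneg]
  · refine (payoffA_le τ hv x y).trans (Finset.sum_le_sum fun i _ => ?_)
    split_ifs <;> simp [hv i]
  · refine le_trans (Finset.sum_nonneg fun i _ => ?_) (le_payoffA τ hv x y)
    split_ifs <;> simp [hv i]

theorem integrable_payoffA (τ : TieRule n) {v : Fin n → ℝ} (hv : ∀ i, 0 ≤ v i)
    (π : Measure ((Fin n → ℝ) × (Fin n → ℝ))) [IsFiniteMeasure π] :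
    Integrable (fun p => payoffA τ v p.1 p.2) π :=
  Integrable.of_bound (measurable_payoffA τ v).aestronglyMeasurable (∑ i, v i)
    (Filter.Eventually.of_forall fun p => abs_payoffA_le τ hv p.1 p.2)

theorem integrable_payoffA_right (τ : TieRule n) {v : Fin n → ℝ} (hv : ∀ i, 0 ≤ v i)
    (x : Fin n → ℝ) (π : Measure (Fin n → ℝ)) [IsFiniteMeasure π] :
    Integrable (fun y => payoffA τ v x y) π :=
  Integrable.of_bound ((measurable_payoffA τ v).comp measurable_prodMk_left).aestronglyMeasurable
    (∑ i, v i) (Filter.Eventually.of_forall fun y => abs_payoffA_le τ hv x y)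

theorem IsCoupling.isProbabilityMeasure {μ : Fin n → Measure ℝ} {π : Measure (Fin n → ℝ)}
    (h : IsCoupling μ π) (i : Fin n) [hμ : IsProbabilityMeasure (μ i)] :
    IsProbabilityMeasure π := by
  rw [← h i] at hμ
  exact (Measure.isProbabilityMeasure_map_iff (measurable_pi_apply i).aemeasurable).1 hμ

theorem integral_sum_indicator {μ : Fin n → Measure ℝ} {π : Measure (Fin n → ℝ)}
    [IsFiniteMeasure π] (h : IsCoupling μ π) (v : Fin n → ℝ) {s : Fin n → Set ℝ}
    (hs : ∀ i, MeasurableSet (s i)) :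
    Integrable (fun y => ∑ i, v i * (s i).indicator 1 (y i)) π ∧
      ∫ y, ∑ i, v i * (s i).indicator 1 (y i) ∂π = ∑ i, v i * (μ i).real (s i) := by
  have hm : ∀ i, MeasurableSet ((fun y : Fin n → ℝ => y i) ⁻¹' s i) := fun i =>
    measurable_pi_apply i (hs i)
  have e : ∀ i, (fun y : Fin n → ℝ => (s i).indicator (1 : ℝ → ℝ) (y i))
      = ((fun y : Fin n → ℝ => y i) ⁻¹' s i).indicator 1 := fun i => rfl
  have hi : ∀ i, Integrable (fun y : Fin n → ℝ => v i * (s i).indicator 1 (y i)) π := fun i => by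
    refine Integrable.const_mul ?_ _
    rw [e i]
    exact (integrable_const (1 : ℝ)).indicator (hm i)
  refine ⟨integrable_finsetSum _ fun i _ => hi i, ?_⟩
  rw [integral_finsetSum _ fun i _ => hi i]
  refine Finset.sum_congr rfl fun i _ => ?_
  rw [integral_const_mul, e i, integral_indicator_one (hm i), ← h i,
    map_measureReal_apply (measurable_pi_apply i) (hs i)]

/-! ### Optimality of the strategies with zero-inflated uniform marginals -/

/-- Beyond `b` the affine function exceeds 1, so the bound needs no upper limit on `x`. -/
theorem zeroUnif_real_Iic_le {q b x : ℝ} (hq0 : 0 ≤ q) (hq1 : q ≤ 1) (hb : 0 < b) (hx0 : 0 ≤ x) :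
    (zeroUnif q b).real (Set.Iic x) ≤ 1 - q + q * (x / b) := by
  rcases le_total x b with h | h
  · exact (zeroUnif_real_Iic hq0 hq1 hb hx0 h).le
  · have := isProbabilityMeasure_zeroUnif hq0 hq1 hb
    have h1 : 1 ≤ x / b := (one_le_div hb).2 h
    exact measureReal_le_one.trans (by nlinarith)

theorem zeroUnif_real_Iio {q b x : ℝ} (hq0 : 0 ≤ q) (hq1 : q ≤ 1) (hb : 0 < b) (hx0 : 0 ≤ x)
    (hxb : x ≤ b) (h : q = 1 ∨ x ≠ 0) :
    (zeroUnif q b).real (Set.Iio x) = 1 - q + q * (x / b) := by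
  have := isProbabilityMeasure_zeroUnif hq0 hq1 hb
  rw [← zeroUnif_real_Iic hq0 hq1 hb hx0 hxb, ← Set.Iio_union_right,
    measureReal_union (by simp) (measurableSet_singleton x), measureReal_def _ {x},
    zeroUnif_singleton h]
  simp

section Optimality

variable {v q b : Fin n → ℝ} {κ : ℝ} {πB : Measure (Fin n → ℝ)}

/-- Even if all ties are won, a bid `x` on battlefield `i` earns at most `v i * (1 - q i) + κ * x`.
As `κ` does not depend on `i`, only the expected total bid matters. -/
theorem utilityA_le_of_lotto (τ : TieRule n) (hv : ∀ i, 0 ≤ v i) (hq : ∀ i, q i ∈ Set.Icc 0 1)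
    (hb : ∀ i, 0 < b i) (hκ0 : 0 ≤ κ) (hκ : ∀ i, v i * q i = κ * b i)
    (hB : IsCoupling (fun i => zeroUnif (q i) (b i)) πB) [IsProbabilityMeasure πB] {T : ℝ}
    {π : Measure (Fin n → ℝ)} (hπ : LottoAdmissible T π) :
    utilityA τ v π πB ≤ ∑ i, v i * (1 - q i) + κ * T := by
  obtain ⟨hprob, hnn, hint, hT⟩ := hπ
  have hint2 : Integrable (fun x : Fin n → ℝ => ∑ i, κ * x i) π :=
    integrable_finsetSum _ fun i _ => (hint i).const_mul κ
  rw [utilityA, integral_prod _ (integrable_payoffA τ hv _)]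
  calc ∫ x, ∫ y, payoffA τ v x y ∂πB ∂π
      ≤ ∫ x, (∑ i, v i * (1 - q i) + ∑ i, κ * x i) ∂π := by
        refine integral_mono_ae (integrable_payoffA τ hv _).integral_prod_left
          ((integrable_const _).add hint2) ?_
        filter_upwards [hnn] with x hx
        obtain ⟨hi, he⟩ := integral_sum_indicator hB v (s := fun i => Set.Iic (x i))
          fun i => measurableSet_Iic
        calc ∫ y, payoffA τ v x y ∂πB
            ≤ ∫ y, ∑ i, v i * (Set.Iic (x i)).indicator 1 (y i) ∂πB := by
              refine integral_mono (integrable_payoffA_right τ hv x πB) hi fun y => ?_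
              refine (payoffA_le τ hv x y).trans_eq (Finset.sum_congr rfl fun i _ => ?_)
              simp [Set.indicator_apply]
          _ = ∑ i, v i * (zeroUnif (q i) (b i)).real (Set.Iic (x i)) := he
          _ ≤ ∑ i, (v i * (1 - q i) + κ * x i) := by
              refine Finset.sum_le_sum fun i _ => ?_
              refine (mul_le_mul_of_nonneg_left
                (zeroUnif_real_Iic_le (hq i).1 (hq i).2 (hb i) (hx i)) (hv i)).trans_eq ?_
              rw [mul_add, ← mul_assoc, hκ i]
              have := (hb i).ne'
              field_simp
          _ = _ := Finset.sum_add_distrib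
    _ = ∑ i, v i * (1 - q i) + κ * ∑ i, ∫ x, x i ∂π := by
        rw [integral_add (integrable_const _) hint2, integral_finsetSum _ fun i _ =>
          (hint i).const_mul κ]
        simp [integral_const_mul, Finset.mul_sum]
    _ ≤ _ := by gcongr

theorem integrable_coord {p : Fin n → ℝ} {πA : Measure (Fin n → ℝ)} (hb : ∀ i, 0 < b i)
    (hA : IsCoupling (fun i => zeroUnif (p i) (b i)) πA) (i : Fin n) :
    Integrable (fun x : Fin n → ℝ => x i) πA := by
  have := integrable_zeroUnif (p := p i) (hb i) (f := fun x => x) continuous_id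
  rw [← show _ = zeroUnif (p i) (b i) from hA i] at this
  exact (integrable_map_measure continuous_id.aestronglyMeasurable
    (measurable_pi_apply i).aemeasurable).1 this

theorem integral_coord {p : Fin n → ℝ} {πA : Measure (Fin n → ℝ)} (hp : ∀ i, p i ∈ Set.Icc 0 1)
    (hb : ∀ i, 0 < b i) (hA : IsCoupling (fun i => zeroUnif (p i) (b i)) πA) (i : Fin n) :
    ∫ x, x i ∂πA = p i * b i / 2 := by
  rw [← integral_id_zeroUnif (hp i).1 (hp i).2 (hb i),
    ← show _ = zeroUnif (p i) (b i) from hA i]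
  exact (integral_map (φ := fun x : Fin n → ℝ => x i) (f := fun x : ℝ => x)
    (measurable_pi_apply i).aemeasurable continuous_id.aestronglyMeasurable).symm

/-- Counting strict wins only already attains the affine bound, since the bids stay in `[0, b i]`
and ties have probability zero: where the opponent has an atom at `0`, `q i ≠ 1` forces `p i = 1`,
so these bids have none. -/
theorem le_utilityA (τ : TieRule n) (hv : ∀ i, 0 ≤ v i) (hq : ∀ i, q i ∈ Set.Icc 0 1)
    (hb : ∀ i, 0 < b i) (hκ : ∀ i, v i * q i = κ * b i)
    (hB : IsCoupling (fun i => zeroUnif (q i) (b i)) πB) [IsProbabilityMeasure πB]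
    {p : Fin n → ℝ} (hp : ∀ i, p i ∈ Set.Icc 0 1) (hpq : ∀ i, p i = 1 ∨ q i = 1)
    {πA : Measure (Fin n → ℝ)} [IsProbabilityMeasure πA]
    (hA : IsCoupling (fun i => zeroUnif (p i) (b i)) πA) :
    ∑ i, v i * (1 - q i) + κ * ∑ i, p i * b i / 2 ≤ utilityA τ v πA πB := by
  have hint := integrable_coord hb hA
  have hint2 : Integrable (fun x : Fin n → ℝ => ∑ i, κ * x i) πA :=
    integrable_finsetSum _ fun i _ => (hint i).const_mul κ
  have hae : ∀ i, ∀ᵐ x ∂πA, x i ∈ Set.Icc 0 (b i) ∧ (q i = 1 ∨ x i ≠ 0) := by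
    intro i
    have h1 : ∀ᵐ z ∂zeroUnif (p i) (b i), z ∈ Set.Icc 0 (b i) := zeroUnif_compl_Icc _ (hb i)
    have h2 : ∀ᵐ z ∂zeroUnif (p i) (b i), q i = 1 ∨ z ≠ 0 := by
      rcases hpq i with h | h
      · rw [h]
        filter_upwards [compl_mem_ae_iff.2 (zeroUnif_singleton (b := b i) (x := 0) (Or.inl rfl))]
          with z hz using Or.inr hz
      · exact Filter.Eventually.of_forall fun _ => Or.inl h
    have h3 := h1.and h2
    rw [← show _ = zeroUnif (p i) (b i) from hA i] at h3
    exact ae_of_ae_map (measurable_pi_apply i).aemeasurable h3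
  rw [utilityA, integral_prod _ (integrable_payoffA τ hv _)]
  calc ∑ i, v i * (1 - q i) + κ * ∑ i, p i * b i / 2
      = ∫ x, (∑ i, v i * (1 - q i) + ∑ i, κ * x i) ∂πA := by
        rw [integral_add (integrable_const _) hint2, integral_finsetSum _ fun i _ =>
          (hint i).const_mul κ]
        simp [integral_const_mul, Finset.mul_sum, integral_coord hp hb hA]
    _ ≤ _ := by
        refine integral_mono_ae ((integrable_const _).add hint2)
          (integrable_payoffA τ hv _).integral_prod_left ?_
        filter_upwards [ae_all_iff.2 hae] with x hx
        obtain ⟨hi, he⟩ := integral_sum_indicator hB v (s := fun i => Set.Iio (x i))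
          fun i => measurableSet_Iio
        calc ∑ i, v i * (1 - q i) + ∑ i, κ * x i
            = ∑ i, v i * (zeroUnif (q i) (b i)).real (Set.Iio (x i)) := by
              rw [← Finset.sum_add_distrib]
              refine Finset.sum_congr rfl fun i _ => ?_
              rw [zeroUnif_real_Iio (hq i).1 (hq i).2 (hb i) (hx i).1.1 (hx i).1.2 (hx i).2,
                mul_add, ← mul_assoc, hκ i]
              have := (hb i).ne'
              field_simp
          _ = ∫ y, ∑ i, v i * (Set.Iio (x i)).indicator 1 (y i) ∂πB := he.symm
          _ ≤ ∫ y, payoffA τ v x y ∂πB := by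
              refine integral_mono hi (integrable_payoffA_right τ hv x πB) fun y => ?_
              refine Eq.trans_le (Finset.sum_congr rfl fun i _ => ?_) (le_payoffA τ hv x y)
              simp [Set.indicator_apply]

end Optimality

/-! ### From couplings to equilibria of both games -/

theorem BlottoAdmissible.lotto {T : ℝ} {π : Measure (Fin n → ℝ)} (h : BlottoAdmissible T π) :
    LottoAdmissible T π := by
  obtain ⟨hprob, hnn, hT⟩ := h
  have hint : ∀ i, Integrable (fun x : Fin n → ℝ => x i) π := by
    intro i
    refine Integrable.of_bound (measurable_pi_apply i).aestronglyMeasurable T ?_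
    filter_upwards [hnn, hT] with x hx hxT
    rw [Real.norm_eq_abs, abs_of_nonneg (hx i)]
    exact (Finset.single_le_sum (fun j _ => hx j) (Finset.mem_univ i)).trans hxT
  refine ⟨hprob, hnn, hint, ?_⟩
  rw [← integral_finsetSum _ fun i _ => hint i]
  calc ∫ x, ∑ i, x i ∂π ≤ ∫ _, T ∂π :=
        integral_mono_ae (integrable_finsetSum _ fun i _ => hint i) (integrable_const T) hT
    _ = T := by simp

/-- Strategies that respect the budgets almost surely and form an equilibrium of the Lotto game
form an equilibrium of the Blotto game. -/
theorem IsLottoEquilibrium.blotto {τ : TieRule n} {TA TB : ℝ} {vA vB : Fin n → ℝ}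
    {πA πB : Measure (Fin n → ℝ)} (h : IsLottoEquilibrium τ TA TB vA vB πA πB)
    (hA : BlottoAdmissible TA πA) (hB : BlottoAdmissible TB πB) :
    IsBlottoEquilibrium τ TA TB vA vB πA πB :=
  ⟨hA, hB, fun π hπ => h.2.2.1 π hπ.lotto, fun π hπ => h.2.2.2 π hπ.lotto⟩

theorem isLottoEquilibrium_of_coupling (τ : TieRule n) {TA TB : ℝ} {vA vB p q b : Fin n → ℝ}
    (hvA : ∀ i, 0 ≤ vA i) (hvB : ∀ i, 0 ≤ vB i) (hp : ∀ i, p i ∈ Set.Icc 0 1)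
    (hq : ∀ i, q i ∈ Set.Icc 0 1) (hpq : ∀ i, p i = 1 ∨ q i = 1) (hb : ∀ i, 0 < b i)
    {κA κB : ℝ} (hκA0 : 0 ≤ κA) (hκB0 : 0 ≤ κB) (hκA : ∀ i, vA i * q i = κA * b i)
    (hκB : ∀ i, vB i * p i = κB * b i) (hTA : ∑ i, p i * b i / 2 = TA)
    (hTB : ∑ i, q i * b i / 2 = TB) {πA πB : Measure (Fin n → ℝ)} [IsProbabilityMeasure πA]
    [IsProbabilityMeasure πB] (hA : IsCoupling (fun i => zeroUnif (p i) (b i)) πA)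
    (hB : IsCoupling (fun i => zeroUnif (q i) (b i)) πB) (hA' : LottoAdmissible TA πA)
    (hB' : LottoAdmissible TB πB) :
    IsLottoEquilibrium τ TA TB vA vB πA πB := by
  refine ⟨hA', hB', fun π hπ => ?_, fun π hπ => ?_⟩
  · refine (utilityA_le_of_lotto τ hvA hq hb hκA0 hκA hB hπ).trans ?_
    rw [← hTA]
    exact le_utilityA τ hvA hq hb hκA hB hp hpq hA
  · have := hπ.1
    rw [← utilityA_swap, ← utilityA_swap]
    refine (utilityA_le_of_lotto τ.swap hvB hp hb hκB0 hκB hA hπ).trans ?_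
    rw [← hTB]
    exact le_utilityA τ.swap hvB hp hb hκB hA hq (fun i => (hpq i).symm) hB

/-! ### Existence of the parameters -/

/-- Eliminating `lam` leaves one equation `g γ = 0`, solved by the intermediate value theorem; `lam`
is then read off from the first budget equation. -/
theorem exists_isLottoParam {TA TB : ℝ} (hTA : 0 < TA) (hTB : 0 < TB) {vA vB : Fin n → ℝ}
    (hvA : ∀ i, 0 < vA i) (hvB : ∀ i, 0 < vB i) (hsumA : ∑ i, vA i = 1) (hsumB : ∑ i, vB i = 1) :
    ∃ γ lam : ℝ, IsLottoParam TA TB vA vB γ lam := by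
  have hne : (Finset.univ : Finset (Fin n)).Nonempty := by
    rw [Finset.nonempty_iff_ne_empty]
    rintro h
    simp [h] at hsumA
  let g : ℝ → ℝ := fun γ => TB * ∑ i, min (γ * vB i) (vA i ^ 2 / (γ * vB i)) -
    TA * ∑ i, min ((γ * vB i) ^ 2 / vA i) (vA i)
  have hg : ContinuousOn g (Set.Ioi 0) := by
    refine ContinuousOn.sub (continuousOn_const.mul (continuousOn_finsetSum _ fun i _ => ?_))
      (continuousOn_const.mul (continuousOn_finsetSum _ fun i _ => ?_))
    · refine ContinuousOn.inf (by fun_prop) (ContinuousOn.div (by fun_prop) (by fun_prop) ?_)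
      intro γ hγ
      exact (mul_pos hγ (hvB i)).ne'
    · exact (by fun_prop : Continuous fun γ => min ((γ * vB i) ^ 2 / vA i) (vA i)).continuousOn
  set c0 := ∑ i, vB i ^ 2 / vA i with hc0
  set d0 := ∑ i, vB i / vA i with hd0
  set c1 := ∑ i, vA i ^ 2 / vB i with hc1
  set d1 := ∑ i, vA i / vB i with hd1
  have hc0' : 0 < c0 := Finset.sum_pos (fun i _ => div_pos (pow_pos (hvB i) 2) (hvA i)) hne
  have hc1' : 0 < c1 := Finset.sum_pos (fun i _ => div_pos (pow_pos (hvA i) 2) (hvB i)) hne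
  have hd0' : ∀ i, vB i / vA i ≤ d0 := fun i => Finset.single_le_sum
    (f := fun i => vB i / vA i) (fun i _ => (div_pos (hvB i) (hvA i)).le) (Finset.mem_univ i)
  have hd1' : ∀ i, vA i / vB i ≤ d1 := fun i => Finset.single_le_sum
    (f := fun i => vA i / vB i) (fun i _ => (div_pos (hvA i) (hvB i)).le) (Finset.mem_univ i)
  have hd0'' : 0 < d0 := Finset.sum_pos (fun i _ => div_pos (hvB i) (hvA i)) hne
  have hd1'' : 0 < d1 := Finset.sum_pos (fun i _ => div_pos (hvA i) (hvB i)) hne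
  -- The terms `d0` and `d1` put all battlefields in the same branch of the minima. The other terms
  -- fix the sign of `g`, whose sums become `γ0` and `γ0 ^ 2 * c0`, respectively `c1 / γ1` and `1`.
  set γ0 := 1 / (d0 + TA * c0 / TB) with hγ0
  set γ1 := d1 + TB * c1 / TA with hγ1
  have hγ0' : 0 < γ0 := by positivity
  have hγ1' : 0 < γ1 := by positivity
  have hinv : γ0 * d0 + γ0 * (TA * c0 / TB) = 1 := by rw [hγ0]; field_simp
  have hg0 : 0 ≤ g γ0 := by
    have hle : ∀ i, γ0 * vB i ≤ vA i := fun i => by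
      rw [← div_le_one (hvA i), mul_div_assoc]
      have : 0 ≤ γ0 * (TA * c0 / TB) := by positivity
      linarith [mul_le_mul_of_nonneg_left (hd0' i) hγ0'.le]
    have e1 : ∑ i, min (γ0 * vB i) (vA i ^ 2 / (γ0 * vB i)) = γ0 := by
      refine Eq.trans ?_ ((Finset.mul_sum _ _ _).symm.trans (by rw [hsumB, mul_one]))
      refine Finset.sum_congr rfl fun i _ => min_eq_left ?_
      have h0 := mul_pos hγ0' (hvB i)
      rw [le_div_iff₀ h0]
      nlinarith [hle i]
    have e2 : ∑ i, min ((γ0 * vB i) ^ 2 / vA i) (vA i) = γ0 ^ 2 * c0 := by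
      rw [hc0, Finset.mul_sum]
      refine Finset.sum_congr rfl fun i _ => ?_
      rw [min_eq_left, mul_pow, mul_div_assoc]
      have h0 := mul_pos hγ0' (hvB i)
      rw [div_le_iff₀ (hvA i)]
      nlinarith [hle i]
    have h3 : γ0 * (TA * c0 / TB) ≤ 1 := by
      have : 0 ≤ γ0 * d0 := by positivity
      linarith
    have h4 : γ0 * TA * c0 ≤ TB := by
      have := mul_le_mul_of_nonneg_right h3 hTB.le
      rw [mul_assoc γ0, div_mul_cancel₀ _ hTB.ne'] at this
      linarith
    change 0 ≤ TB * _ - TA * _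
    rw [e1, e2]
    nlinarith
  have hg1 : g γ1 ≤ 0 := by
    have hle : ∀ i, vA i ≤ γ1 * vB i := fun i => by
      rw [← div_le_iff₀ (hvB i)]
      have : 0 ≤ TB * c1 / TA := by positivity
      linarith [hd1' i]
    have e1 : ∑ i, min (γ1 * vB i) (vA i ^ 2 / (γ1 * vB i)) = c1 / γ1 := by
      rw [hc1, Finset.sum_div]
      refine Finset.sum_congr rfl fun i _ => ?_
      have h0 := mul_pos hγ1' (hvB i)
      rw [min_eq_right, div_div, mul_comm (vB i)]
      rw [div_le_iff₀ h0]
      nlinarith [hle i, hvA i]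
    have e2 : ∑ i, min ((γ1 * vB i) ^ 2 / vA i) (vA i) = 1 := by
      rw [← hsumA]
      refine Finset.sum_congr rfl fun i _ => min_eq_right ?_
      rw [le_div_iff₀ (hvA i)]
      nlinarith [hle i, hvA i]
    have h3 : TB * c1 ≤ TA * γ1 := by
      rw [hγ1, mul_add, mul_div_cancel₀ _ hTA.ne']
      have : 0 ≤ TA * d1 := by positivity
      linarith
    change TB * _ - TA * _ ≤ 0
    rw [e1, e2, mul_one, sub_nonpos, ← mul_div_assoc, div_le_iff₀ hγ1']
    exact h3
  obtain ⟨γ, hγ, hgγ⟩ := isPreconnected_Ioi.intermediate_value (Set.mem_Ioi.2 hγ1')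
    (Set.mem_Ioi.2 hγ0') hg ⟨hg1, hg0⟩
  have hγ' : 0 < γ := hγ
  have hS : 0 < ∑ i, min (γ * vB i) (vA i ^ 2 / (γ * vB i)) :=
    Finset.sum_pos (fun i _ => by have := hvA i; have := hvB i; positivity) hne
  refine ⟨γ, (∑ i, min (γ * vB i) (vA i ^ 2 / (γ * vB i))) / (2 * TA), hγ, by positivity, ?_, ?_⟩
  · field_simp
  · have : TB * ∑ i, min (γ * vB i) (vA i ^ 2 / (γ * vB i)) =
      TA * ∑ i, min ((γ * vB i) ^ 2 / vA i) (vA i) := sub_eq_zero.1 hgγ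
    rw [div_mul_eq_mul_div, mul_comm _ TB, this]
    field_simp

/-! ### Bound on the largest bid -/

/-- Cauchy–Schwarz in pointwise form: `2 * r * |x i| ≤ x i ^ 2 + r ^ 2`. -/
theorem sum_mul_abs_le {w x : Fin n → ℝ} (hw : ∀ i, 0 ≤ w i) (hw1 : ∑ i, w i = 1) {r : ℝ}
    (hr : 0 < r) (h : ∑ i, w i * x i ^ 2 ≤ r ^ 2) : ∑ i, w i * |x i| ≤ r := by
  have h1 : ∀ i, w i * |x i| * (2 * r) ≤ w i * x i ^ 2 + r ^ 2 * w i := fun i => by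
    have := mul_nonneg (hw i) (sq_nonneg (|x i| - r))
    rw [sub_sq, sq_abs] at this
    linarith
  have h2 := Finset.sum_le_sum fun i (_ : i ∈ Finset.univ) => h1 i
  rw [← Finset.sum_mul, Finset.sum_add_distrib, ← Finset.mul_sum, hw1] at h2
  nlinarith

/-- The inequality behind the bound on the largest bid, in terms of the normalized ratios
`t i = vA i / (γ * vB i)`. -/
theorem one_sub_le_sum_min {w t : Fin n → ℝ} (hw : ∀ i, 0 < w i) (ht : ∀ i, 0 < t i)
    (hw1 : ∑ i, w i = 1) {γ r : ℝ} (hγ : 0 < γ) (hr : 0 < r) (hmean : γ * ∑ i, w i * t i = 1)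
    (hvar : γ ^ 2 * ∑ i, w i * t i ^ 2 ≤ 1 + r ^ 2)
    (hle : ∑ i, w i * min (t i)⁻¹ (t i) ≤ ∑ i, w i * min 1 (t i ^ 2)) :
    1 - r ≤ ∑ i, w i * min 1 (t i ^ 2) := by
  have hsq : ∀ c : ℝ, ∑ i, w i * (1 - c * t i) ^ 2
      = 1 - 2 * c * ∑ i, w i * t i + c ^ 2 * ∑ i, w i * t i ^ 2 := fun c => by
    rw [show (1 : ℝ) - 2 * c * ∑ i, w i * t i = ∑ i, w i - 2 * c * ∑ i, w i * t i by rw [hw1],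
      Finset.mul_sum, Finset.mul_sum, ← Finset.sum_sub_distrib, ← Finset.sum_add_distrib]
    exact Finset.sum_congr rfl fun i _ => by ring
  -- Under the weights `w`, the variable `y = γ * t` has mean 1 and variance at most `r ^ 2`. For `γ
  -- ≤ 1` one has `y ≤ t`, so `min 1 (t ^ 2) ≥ min 1 (y ^ 2) ≥ y - |1 - y|`, whose mean is at least
  -- `1 - r`.
  rcases le_or_gt γ 1 with h1 | h1
  · have h2 : ∑ i, w i * |1 - γ * t i| ≤ r := by
      refine sum_mul_abs_le (fun i => (hw i).le) hw1 hr ?_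
      rw [hsq, mul_assoc 2, hmean]
      linarith
    have h3 : ∀ i, w i - w i * |1 - γ * t i| - (w i - γ * (w i * t i)) ≤ w i * min 1 (t i ^ 2) := by
      intro i
      have e : w i - w i * |1 - γ * t i| - (w i - γ * (w i * t i))
          = w i * (γ * t i - |1 - γ * t i|) := by ring
      rw [e]
      refine mul_le_mul_of_nonneg_left (le_min ?_ ?_) (hw i).le
      · linarith [neg_abs_le (1 - γ * t i), le_abs_self (1 - γ * t i), abs_sub_comm 1 (γ * t i),
          le_abs_self (γ * t i - 1)]
      · have h4 : (γ * t i) ^ 2 ≤ t i ^ 2 := by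
          rw [mul_pow]
          have := pow_le_one₀ (n := 2) hγ.le h1
          nlinarith [sq_nonneg (t i)]
        nlinarith [le_abs_self (1 - γ * t i), sq_nonneg (1 - γ * t i)]
    have h4 := Finset.sum_le_sum fun i (_ : i ∈ Finset.univ) => h3 i
    rw [Finset.sum_sub_distrib, Finset.sum_sub_distrib, Finset.sum_sub_distrib, ← Finset.mul_sum,
      hmean, hw1] at h4
    linarith
  -- For `γ > 1` the comparison `hle` makes the mean of `t ^ 2 - t` nonnegative, whence `γ ≤ 1 + r ^
  -- 2`. Then `t` itself has mean square distance at most `r ^ 2` from 1, and `min t⁻¹ t ≥ 1 - |1 -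
  -- t|` finishes.
  · have h2 : ∑ i, w i * min 1 (t i ^ 2) - ∑ i, w i * min (t i)⁻¹ (t i)
        ≤ ∑ i, w i * t i ^ 2 - ∑ i, w i * t i := by
      rw [← Finset.sum_sub_distrib, ← Finset.sum_sub_distrib]
      refine Finset.sum_le_sum fun i _ => ?_
      rw [← mul_sub, ← mul_sub]
      refine mul_le_mul_of_nonneg_left ?_ (hw i).le
      rcases le_total (t i) 1 with h | h
      · rw [min_eq_right (pow_le_one₀ (ht i).le h),
          min_eq_right (h.trans ((one_le_inv₀ (ht i)).2 h))]
      · rw [min_eq_left (one_le_pow₀ h), min_eq_left ((inv_le_one_of_one_le₀ h).trans h)]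
        have h5 : (t i)⁻¹ * t i = 1 := inv_mul_cancel₀ (ht i).ne'
        have h6 := inv_le_one_of_one_le₀ h
        have h7 : 0 < (t i)⁻¹ := inv_pos.2 (ht i)
        nlinarith [mul_nonneg h7.le (sub_nonneg.2 h)]
    have h3 : γ ≤ 1 + r ^ 2 := by
      have h4 : γ * (γ * ∑ i, w i * t i) ≤ γ ^ 2 * ∑ i, w i * t i ^ 2 := by
        rw [← mul_assoc, ← pow_two]
        exact mul_le_mul_of_nonneg_left (by linarith) (sq_nonneg γ)
      rw [hmean] at h4
      linarith
    have h4 : ∑ i, w i * |1 - 1 * t i| ≤ r := by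
      refine sum_mul_abs_le (fun i => (hw i).le) hw1 hr ?_
      rw [hsq]
      refine le_of_mul_le_mul_left ?_ (pow_pos hγ 2)
      have : γ ^ 2 * (1 - 2 * 1 * ∑ i, w i * t i + 1 ^ 2 * ∑ i, w i * t i ^ 2)
          = γ ^ 2 - 2 * γ * (γ * ∑ i, w i * t i) + γ ^ 2 * ∑ i, w i * t i ^ 2 := by ring
      rw [this, hmean]
      -- The claim reduces to `(γ - 1) ^ 2 ≤ r ^ 2 * (γ ^ 2 - 1)`; `h5` and `h6` add up to exactly
      -- this.
      have h5 : 0 ≤ (γ - 1) * (1 + r ^ 2 - γ) :=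
        mul_nonneg (by linarith) (by linarith)
      have h6 : 0 ≤ (γ - 1) * (γ * r ^ 2) := mul_nonneg (by linarith) (by positivity)
      nlinarith
    have h5 : ∀ i, w i - w i * |1 - 1 * t i| ≤ w i * min (t i)⁻¹ (t i) := by
      intro i
      rw [show w i - w i * |1 - 1 * t i| = w i * (1 - |1 - 1 * t i|) by ring, one_mul]
      refine mul_le_mul_of_nonneg_left (le_min ?_ ?_) (hw i).le
      · rcases le_total (t i) 1 with h | h
        · exact (by linarith [abs_nonneg (1 - t i)] : 1 - |1 - t i| ≤ 1).trans
            ((one_le_inv₀ (ht i)).2 h)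
        · have h6 : (t i)⁻¹ * t i = 1 := inv_mul_cancel₀ (ht i).ne'
          have h7 := inv_le_one_of_one_le₀ h
          rw [abs_sub_comm, abs_of_nonneg (sub_nonneg.2 h)]
          nlinarith
      · linarith [le_abs_self (1 - t i)]
    have h6 := Finset.sum_le_sum fun i (_ : i ∈ Finset.univ) => h5 i
    rw [Finset.sum_sub_distrib, hw1] at h6
    linarith

/-- In the normalized ratios, the budget equation of `A` reads `2 * lam * TA = γ * ∑ i, vB i * min 1
(t i ^ 2)`, and `TB ≤ TA` becomes the comparison of the two sums of minima. -/
theorem IsLottoParam.mul_le {TA TB : ℝ} (hTB : 0 < TB) (hTAB : TB ≤ TA) {vA vB : Fin n → ℝ}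
    (hvA : ∀ i, 0 < vA i) (hvB : ∀ i, 0 < vB i) (hsumA : ∑ i, vA i = 1) (hsumB : ∑ i, vB i = 1)
    {r : ℝ} (hr : 0 < r) (hbal : chiSq vA vB ≤ r ^ 2)
    (hmax : ∀ i, vB i ≤ TB / (2 * TA) * (1 - r)) {γ lam : ℝ} (h : IsLottoParam TA TB vA vB γ lam)
    (i : Fin n) : γ * vB i ≤ lam * TB := by
  obtain ⟨hγ, hlam, hA, hB⟩ := h
  have hTA : 0 < TA := hTB.trans_le hTAB
  have e1 : ∀ i, min (γ * vB i) (vA i ^ 2 / (γ * vB i))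
      = γ * (vB i * min 1 ((vA i / (γ * vB i)) ^ 2)) := fun i => by
    have := hvB i
    rw [← mul_assoc, mul_min_of_nonneg _ _ (by positivity), mul_one]
    congr 1
    field_simp
  have e2 : ∀ i, min ((γ * vB i) ^ 2 / vA i) (vA i)
      = γ * (vB i * min (vA i / (γ * vB i))⁻¹ (vA i / (γ * vB i))) := fun i => by
    have := hvB i
    have := hvA i
    rw [← mul_assoc, mul_min_of_nonneg _ _ (by positivity)]
    congr 1 <;> field_simp
  simp only [e1, e2, ← Finset.mul_sum] at hA hB
  have key := one_sub_le_sum_min (w := vB) (t := fun i => vA i / (γ * vB i)) hvB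
    (fun i => div_pos (hvA i) (mul_pos hγ (hvB i))) hsumB hγ hr
    (by
      rw [Finset.mul_sum, ← hsumA]
      refine Finset.sum_congr rfl fun i _ => ?_
      have := hvB i
      field_simp)
    (by
      have : γ ^ 2 * ∑ i, vB i * (vA i / (γ * vB i)) ^ 2 = ∑ i, vA i ^ 2 / vB i := by
        rw [Finset.mul_sum]
        refine Finset.sum_congr rfl fun i _ => ?_
        have := hvB i
        field_simp
      rw [this]
      unfold chiSq at hbal
      linarith)
    (by
      have h1 : lam * TB ≤ lam * TA := mul_le_mul_of_nonneg_left hTAB hlam.le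
      rw [hA, hB] at h1
      refine le_of_mul_le_mul_left ?_ hγ
      linarith)
  have h1 : γ * (1 - r) ≤ 2 * (lam * TA) := by
    rw [hA]
    linarith [mul_le_mul_of_nonneg_left key hγ.le]
  calc γ * vB i ≤ γ * (TB / (2 * TA) * (1 - r)) := mul_le_mul_of_nonneg_left (hmax i) hγ.le
    _ = TB / (2 * TA) * (γ * (1 - r)) := by ring
    _ ≤ TB / (2 * TA) * (2 * (lam * TA)) := mul_le_mul_of_nonneg_left h1 (by positivity)
    _ = lam * TB := by field_simp

/-! ### The marginals as zero-inflated uniform laws -/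

theorem lottoA_eq {vA vB : Fin n → ℝ} (hvB : ∀ i, 0 < vB i) {γ : ℝ}
    (hγ : 0 < γ) (lam : ℝ) :
    lottoA vA vB γ lam =
      fun i => zeroUnif (min 1 (vA i / (γ * vB i))) (min (γ * vB i) (vA i) / lam) := by
  funext i
  have h0 := mul_pos hγ (hvB i)
  unfold lottoA
  split_ifs with h
  · rw [le_div_iff₀ (hvB i)] at h
    rw [unif_eq_zeroUnif, min_eq_left ((one_le_div h0).2 h), min_eq_left h]
  · rw [not_le, div_lt_iff₀ (hvB i)] at h
    rw [min_eq_right ((div_le_one h0).2 h.le), min_eq_right h.le]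

theorem lottoB_eq {vA vB : Fin n → ℝ} (hvA : ∀ i, 0 < vA i) (hvB : ∀ i, 0 < vB i)
    (γ lam : ℝ) :
    lottoB vA vB γ lam =
      fun i => zeroUnif (min 1 (γ * vB i / vA i)) (min (γ * vB i) (vA i) / lam) := by
  funext i
  unfold lottoB
  split_ifs with h
  · rw [le_div_iff₀ (hvB i)] at h
    rw [min_eq_right ((div_le_one (hvA i)).2 h), min_eq_left h]
  · rw [not_le, div_lt_iff₀ (hvB i)] at h
    rw [unif_eq_zeroUnif, min_eq_left ((one_le_div (hvA i)).2 h.le), min_eq_right h.le]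

end Blotto

/-! ### The equilibrium theorem -/

theorem mainTheorem3 (n : ℕ) (hn : 2 ≤ n) (TA TB : ℝ) (hTB : 0 < TB) (hTAB : TB ≤ TA)
    (vA vB : Fin n → ℝ) (hvA : ∀ i, 0 < vA i) (hvB : ∀ i, 0 < vB i)
    (hsumA : ∑ i, vA i = 1) (hsumB : ∑ i, vB i = 1)
    (r : ℝ) (hr0 : 0 < r) (hr1 : r < 1)
    (hbal : max (Blotto.chiSq vA vB) (Blotto.chiSq vB vA) ≤ r ^ 2)
    (hmax : ∀ i, vB i ≤ TB / (2 * TA) * (1 - r)) :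
    (∃ γ lam : ℝ, Blotto.IsLottoParam TA TB vA vB γ lam) ∧
    ∀ γ lam : ℝ, Blotto.IsLottoParam TA TB vA vB γ lam →
      ∃ πA πB : MeasureTheory.Measure (Fin n → ℝ),
        Blotto.IsCoupling (Blotto.lottoA vA vB γ lam) πA ∧
        Blotto.IsCoupling (Blotto.lottoB vA vB γ lam) πB ∧
        ∀ τ : Blotto.TieRule n,
          Blotto.IsLottoEquilibrium τ TA TB vA vB πA πB ∧
          Blotto.IsBlottoEquilibrium τ TA TB vA vB πA πB := by
  have hTA : 0 < TA := hTB.trans_le hTAB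
  refine ⟨Blotto.exists_isLottoParam hTA hTB hvA hvB hsumA hsumB, fun γ lam hparam => ?_⟩
  have hbid := hparam.mul_le hTB hTAB hvA hvB hsumA hsumB hr0 ((le_max_left _ _).trans hbal) hmax
  obtain ⟨hγ, hlam, hparA, hparB⟩ := hparam
  rw [Blotto.lottoA_eq hvB hγ, Blotto.lottoB_eq hvA hvB]
  set b : Fin n → ℝ := fun i => min (γ * vB i) (vA i) / lam with hbdef
  set p : Fin n → ℝ := fun i => min 1 (vA i / (γ * vB i))
  set q : Fin n → ℝ := fun i => min 1 (γ * vB i / vA i)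
  have hp_i : ∀ i, p i = min 1 (vA i / (γ * vB i)) := fun _ => rfl
  have hq_i : ∀ i, q i = min 1 (γ * vB i / vA i) := fun _ => rfl
  have h0 : ∀ i, 0 < γ * vB i := fun i => mul_pos hγ (hvB i)
  have hb : ∀ i, 0 < b i := fun i => div_pos (lt_min (h0 i) (hvA i)) hlam
  have hbTB : ∀ i, b i ≤ TB := fun i => by
    rw [hbdef, div_le_iff₀ hlam, mul_comm TB]
    exact (min_le_left _ _).trans (hbid i)
  have hp : ∀ i, p i ∈ Set.Icc 0 1 := fun i =>
    ⟨le_min zero_le_one (div_pos (hvA i) (h0 i)).le, min_le_left _ _⟩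
  have hq : ∀ i, q i ∈ Set.Icc 0 1 := fun i =>
    ⟨le_min zero_le_one (div_pos (h0 i) (hvA i)).le, min_le_left _ _⟩
  -- The quantities `p i * γ * vB i`, `q i * vA i` and `lam * b i` are all the same minimum. This
  -- equalizes the slopes across battlefields: `lam` for `A` and `lam / γ` for `B`.
  have hp_eq : ∀ i, p i * (γ * vB i) = min (γ * vB i) (vA i) := fun i => by
    rw [hp_i, min_mul_of_nonneg _ _ (h0 i).le, one_mul, div_mul_cancel₀ _ (h0 i).ne']
  have hq_eq : ∀ i, q i * vA i = min (γ * vB i) (vA i) := fun i => by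
    rw [hq_i, min_mul_of_nonneg _ _ (hvA i).le, one_mul, div_mul_cancel₀ _ (hvA i).ne', min_comm]
  have hb_eq : ∀ i, lam * b i = min (γ * vB i) (vA i) := fun i => mul_div_cancel₀ _ hlam.ne'
  have hpq : ∀ i, p i = 1 ∨ q i = 1 := fun i => by
    rcases le_total (γ * vB i) (vA i) with h | h
    · exact Or.inl (min_eq_left ((one_le_div (h0 i)).2 h))
    · exact Or.inr (min_eq_left ((one_le_div (hvA i)).2 h))
  have hsA : ∑ i, p i * b i = 2 * TA := by
    refine mul_left_cancel₀ hlam.ne' ?_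
    rw [mul_left_comm, hparA, Finset.mul_sum, ← mul_assoc, mul_one_div_cancel two_ne_zero, one_mul]
    refine Finset.sum_congr rfl fun i _ => ?_
    rw [mul_left_comm, hb_eq]
    have h1 := h0 i
    rcases le_total (γ * vB i) (vA i) with h | h
    · rw [hp_i, min_eq_left h, min_eq_left ((one_le_div h1).2 h), one_mul, min_eq_left]
      rw [le_div_iff₀ h1]; nlinarith
    · rw [hp_i, min_eq_right h, min_eq_right ((div_le_one h1).2 h), min_eq_right]
      · ring
      · rw [div_le_iff₀ h1]; nlinarith [hvA i]
  have hsB : ∑ i, q i * b i = 2 * TB := by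
    refine mul_left_cancel₀ hlam.ne' ?_
    rw [mul_left_comm, hparB, Finset.mul_sum, ← mul_assoc, mul_one_div_cancel two_ne_zero, one_mul]
    refine Finset.sum_congr rfl fun i _ => ?_
    rw [mul_left_comm, hb_eq]
    have h1 := h0 i
    have h2 := hvA i
    rcases le_total (γ * vB i) (vA i) with h | h
    · rw [hq_i, min_eq_left h, min_eq_right ((div_le_one h2).2 h), min_eq_left]
      · ring
      · rw [div_le_iff₀ h2]; nlinarith
    · rw [hq_i, min_eq_right h, min_eq_left ((one_le_div h2).2 h), one_mul, min_eq_right]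
      rw [le_div_iff₀ h2]; nlinarith
  obtain ⟨πA, hπA, hsumπA⟩ := Blotto.exists_zeroUnif_coupling hn hTA hp hb
    (fun i => (hbTB i).trans hTAB) hsA
  obtain ⟨πB, hπB, hsumπB⟩ := Blotto.exists_zeroUnif_coupling hn hTB hq hb hbTB hsB
  have i0 : Fin n := ⟨0, by omega⟩
  have := Blotto.isProbabilityMeasure_zeroUnif (hp i0).1 (hp i0).2 (hb i0)
  have := Blotto.isProbabilityMeasure_zeroUnif (hq i0).1 (hq i0).2 (hb i0)
  have hprobA := hπA.isProbabilityMeasure i0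
  have hprobB := hπB.isProbabilityMeasure i0
  have hadmA : Blotto.BlottoAdmissible TA πA :=
    ⟨hprobA, hsumπA.mono fun x hx => hx.1, hsumπA.mono fun x hx => hx.2.le⟩
  have hadmB : Blotto.BlottoAdmissible TB πB :=
    ⟨hprobB, hsumπB.mono fun x hx => hx.1, hsumπB.mono fun x hx => hx.2.le⟩
  refine ⟨πA, πB, hπA, hπB, fun τ => ?_⟩
  have hlotto : Blotto.IsLottoEquilibrium τ TA TB vA vB πA πB :=
    Blotto.isLottoEquilibrium_of_coupling τ (fun i => (hvA i).le) (fun i => (hvB i).le) hp hq hpq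
      hb hlam.le (div_pos hlam hγ).le (κA := lam) (κB := lam / γ)
      (fun i => by rw [hb_eq, mul_comm, hq_eq])
      (fun i => by
        rw [div_mul_eq_mul_div, hb_eq, eq_div_iff hγ.ne', ← hp_eq]; ring)
      (by rw [← Finset.sum_div, hsA]; ring) (by rw [← Finset.sum_div, hsB]; ring)
      hπA hπB hadmA.lotto hadmB.lotto
  exact ⟨hlotto, hlotto.blotto hadmA hadmB⟩
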